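/- Let $k\ge 1$, let $\zeta$ be a primitive $k$-th root of unity, let $X$ be a compact Hausdorff space, and let $\mathcal M\to X$ be a matrix-algebra bundle: a bundle of $*$-algebras locally isomorphic, as such, to $U\times M_n(\mathbb C)$, where $n$ may vary with the point. Let $\triangleright$ be an action of $\mathbb Z/k$ on $\mathcal M$ by bundle automorphisms that cover $\mathrm{id}_X$ and are $*$-automorphisms on each fiber. It induces an action on the algebra $\Gamma(\mathcal M)$ of continuous sections. For an action of $\mathbb Z/k$ on a unital $C^*$-algebra $A$, the (plain) local-triviality dimension $\dim_{LT}^{\mathbb Z/k}(A)\in\mathbb N\cup\{\infty\}$ is the infimum of the $n\in\mathbb N$ for which there are $\mathbb Z/k$-equivariant $*$-homomorphisms $\rho_0,\dots,\rho_n: C_0((0,1])\otimes C(\mathbb Z/k)\to A$ with $\sum_{j=0}^n\rho_j(t\otimes 1)=1$, where $t$ is the identity function on $(0,1]$. The index $\mathrm{ix}(\mathcal M,\triangleright)$ is the smallest $m\in\mathbb N$ (or $\infty$ if there is none) for which there is an open cover $X=\bigcup_{i=0}^m U_i$ such that over each $U_i$ the bundle $\mathcal M$ is trivial, the action is inner,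 induced by some unitary section $s_i\in\Gamma(\mathcal M|_{U_i})$ with $s_i^k=1$ (the generator $1\in\mathbb Z/k$ acts as conjugation by $s_i$), and, for a suitable trivialization of $\mathcal M|_{U_i}$, all eigenspaces of $s_i$ are trivial as vector bundles over $U_i$. Here, when ranks vary over $U_i$, "trivial" means trivial over each of the clopen pieces of $U_i$ on which the ranks are constant. Then the following conditions are equivalent. (a) $\dim_{LT}^{\mathbb Z/k}(\Gamma(\mathcal M))\le \mathrm{ix}(\mathcal M,\triangleright)$. (b) $\dim_{LT}^{\mathbb Z/k}(\Gamma(\mathcal M))<\infty$. (c) At every $x\in X$, some unitary $v_x\in\mathcal M_x\cong M_{n_x}(\mathbb C)$ with $v_x^k=1$ such that the generator $1\in\mathbb Z/k$ acts on $\mathcal M_x$ as conjugation by $v_x$ has the property that its $\zeta^j$-eigenspaces, $j\in\mathbb Z/k$, all have the same dimension. (c$'$) At every $x\in X$, every such unitary $v_x$ has that property. -/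

import Mathlib

open scoped ZeroAtInfty

noncomputable section

/-! ### The local-triviality dimension -/

/-- The element `t ⊗ 1` of `C₀((0,1]) ⊗ C(G) = C₀((0,1] × G)`, i.e. the function `(t, g) ↦ t`. -/
def coneCoordinate (G : Type*) [TopologicalSpace G] [CompactSpace G] :
    C₀(Set.Ioc (0 : ℝ) 1 × G, ℂ) where
  toFun p := ((p.1 : ℝ) : ℂ)
  continuous_toFun := by fun_prop
  zero_at_infty' := by
    rw [Metric.tendsto_nhds]
    intro ε hε
    rw [Filter.eventually_iff, Filter.mem_cocompact]
    refine ⟨(Set.Icc (min ε 1) 1).preimage (fun t : Set.Ioc (0 : ℝ) 1 => (t : ℝ)) ×ˢ Set.univ,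
      IsCompact.prod ?_ isCompact_univ, ?_⟩
    · rw [Subtype.isCompact_iff]
      have h : (Subtype.val '' ((fun t : Set.Ioc (0 : ℝ) 1 => (t : ℝ)) ⁻¹' Set.Icc (min ε 1) 1))
          = Set.Icc (min ε 1) 1 := by
        ext y
        constructor
        · rintro ⟨z, hz, rfl⟩
          exact hz
        · intro hy
          exact ⟨⟨y, lt_of_lt_of_le (lt_min hε one_pos) hy.1, hy.2⟩, hy, rfl⟩
      rw [h]
      exact isCompact_Icc
    · rintro ⟨⟨t, ht0, ht1⟩, g⟩ hp
      simp only [Set.mem_compl_iff, Set.mem_prod, Set.mem_preimage, Set.mem_Icc, Set.mem_univ,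
        and_true, not_and_or, not_le] at hp
      have hlt : t < ε := by
        rcases hp with h | h
        · exact lt_of_lt_of_le h (min_le_left _ _)
        · exact absurd ht1 (not_le.mpr h)
      simpa [abs_of_pos ht0] using hlt

/-- Right translation by `g` on `C₀((0,1]) ⊗ C(G) = C₀((0,1] × G)`, i.e. the action
`(g ▷ f)(t, h) = f(t, h g)` which corresponds to the coaction `id ⊗ Δ`. -/
def coneTranslate {G : Type*} [TopologicalSpace G] [Group G] [IsTopologicalGroup G] (g : G)
    (f : C₀(Set.Ioc (0 : ℝ) 1 × G, ℂ)) : C₀(Set.Ioc (0 : ℝ) 1 × G, ℂ) :=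
  f.comp ((Homeomorph.refl (Set.Ioc (0 : ℝ) 1)).prodCongr (Homeomorph.mulRight g)).toCocompactMap

/-- The (plain) local-triviality dimension of an action `α` of a compact group `G` on a unital
`*`-algebra `A`: the infimum in `ℕ ∪ {∞}` of the `n` for which there are `G`-equivariant
`*`-homomorphisms `ρ₀, …, ρₙ : C₀((0,1]) ⊗ C(G) → A` with `∑ ρⱼ(t ⊗ 1) = 1`. -/
def ltDim {G : Type*} [TopologicalSpace G] [Group G] [IsTopologicalGroup G] [CompactSpace G]
    {A : Type*} [Ring A] [StarRing A] [Algebra ℂ A] (α : G →* (A ≃⋆ₐ[ℂ] A)) : ℕ∞ :=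
  sInf {N : ℕ∞ | ∃ n : ℕ, N = n ∧
    ∃ ρ : Fin (n + 1) → (C₀(Set.Ioc (0 : ℝ) 1 × G, ℂ) →⋆ₙₐ[ℂ] A),
      (∀ j g f, α g (ρ j f) = ρ j (coneTranslate g f)) ∧ ∑ j, ρ j (coneCoordinate G) = 1}

/-! ### Matrix bundles -/

/-- A local trivialization with model fibre `Mₙ(ℂ)` respects the `*`-algebra structures if it is
fibrewise a `*`-isomorphism. -/
def Bundle.Trivialization.IsStarAlg {X : Type*} [TopologicalSpace X] {E : X → Type*}
    [∀ x, Ring (E x)] [∀ x, StarRing (E x)] [∀ x, Algebra ℂ (E x)]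
    [TopologicalSpace (Bundle.TotalSpace Unit E)] {n : ℕ}
    (e : Bundle.Trivialization (Matrix (Fin n) (Fin n) ℂ)
      (Bundle.TotalSpace.proj : Bundle.TotalSpace Unit E → X)) : Prop :=
  ∀ x ∈ e.baseSet, ∃ φ : E x ≃⋆ₐ[ℂ] Matrix (Fin n) (Fin n) ℂ, ∀ a : E x, (e ⟨x, a⟩).2 = φ a

/-- A matrix-algebra bundle over `X`: a family of `*`-algebras with a topology on its total space
which is locally isomorphic to `U × Mₙ(ℂ)`, where `n` may depend on the point. -/
structure MatrixBundle (X : Type*) [TopologicalSpace X] where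
  Fiber : X → Type*
  [ring : ∀ x, Ring (Fiber x)]
  [starRing : ∀ x, StarRing (Fiber x)]
  [algebra : ∀ x, Algebra ℂ (Fiber x)]
  [starModule : ∀ x, StarModule ℂ (Fiber x)]
  [topology : TopologicalSpace (Bundle.TotalSpace Unit Fiber)]
  exists_trivialization : ∀ x : X, ∃ n : ℕ,
    ∃ e : Bundle.Trivialization (Matrix (Fin n) (Fin n) ℂ)
      (Bundle.TotalSpace.proj : Bundle.TotalSpace Unit Fiber → X),
      x ∈ e.baseSet ∧ e.IsStarAlg

namespace MatrixBundle

attribute [instance] MatrixBundle.ring MatrixBundle.starRing MatrixBundle.algebra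
  MatrixBundle.starModule MatrixBundle.topology

variable {X : Type*} [TopologicalSpace X] (M : MatrixBundle X)

/-- The total space of the bundle. -/
abbrev Total : Type _ := Bundle.TotalSpace Unit M.Fiber

/-- The local trivializations of `M` by `U × Mₙ(ℂ)`, not yet required to be multiplicative. -/
abbrev Triv (n : ℕ) : Type _ :=
  Bundle.Trivialization (Matrix (Fin n) (Fin n) ℂ) (Bundle.TotalSpace.proj : M.Total → X)

variable {M}

theorem continuousAt_section {n : ℕ} (e : M.Triv n) {x : X} (hx : x ∈ e.baseSet)
    (s : ∀ x, M.Fiber x) :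
    ContinuousAt (fun y => (⟨y, s y⟩ : M.Total)) x ↔
      ContinuousAt (fun y => (e ⟨y, s y⟩).2) x := by
  have hsrc : (fun y => (⟨y, s y⟩ : M.Total)) ⁻¹' e.source = e.baseSet := by
    ext y
    simp [e.mem_source]
  rw [e.toOpenPartialHomeomorph.continuousAt_iff_continuousAt_comp_left
    (f := fun y => (⟨y, s y⟩ : M.Total)) (x := x) (by rw [hsrc]; exact e.open_baseSet.mem_nhds hx)]
  have heq : (e.toOpenPartialHomeomorph ∘ fun y => (⟨y, s y⟩ : M.Total)) =ᶠ[nhds x]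
      fun y => (y, (e ⟨y, s y⟩).2) := by
    filter_upwards [e.open_baseSet.mem_nhds hx] with y hy
    exact Prod.ext (e.coe_fst (e.mem_source.2 hy)) rfl
  rw [continuousAt_congr heq]
  exact ⟨fun h => h.snd, fun h => continuousAt_id.prodMk h⟩

variable (M)

/-- The `*`-algebra `Γ(M)` of continuous sections of `M`, with pointwise operations. -/
def sections : StarSubalgebra ℂ (∀ x, M.Fiber x) where
  carrier := {s | Continuous fun x => (⟨x, s x⟩ : M.Total)}
  mul_mem' {s t} hs ht := continuous_iff_continuousAt.2 fun x => by
    obtain ⟨n, e, hx, he⟩ := M.exists_trivialization x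
    have h1 := (continuousAt_section e hx s).1 hs.continuousAt
    have h2 := (continuousAt_section e hx t).1 ht.continuousAt
    refine (continuousAt_section e hx _).2 ((h1.mul h2).congr ?_)
    filter_upwards [e.open_baseSet.mem_nhds hx] with y hy
    obtain ⟨φ, hφ⟩ := he y hy
    simp [hφ]
  add_mem' {s t} hs ht := continuous_iff_continuousAt.2 fun x => by
    obtain ⟨n, e, hx, he⟩ := M.exists_trivialization x
    have h1 := (continuousAt_section e hx s).1 hs.continuousAt
    have h2 := (continuousAt_section e hx t).1 ht.continuousAt
    refine (continuousAt_section e hx _).2 ((h1.add h2).congr ?_)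
    filter_upwards [e.open_baseSet.mem_nhds hx] with y hy
    obtain ⟨φ, hφ⟩ := he y hy
    simp [hφ]
  algebraMap_mem' c := continuous_iff_continuousAt.2 fun x => by
    obtain ⟨n, e, hx, he⟩ := M.exists_trivialization x
    refine (continuousAt_section e hx _).2
      ((continuousAt_const (y := algebraMap ℂ (Matrix (Fin n) (Fin n) ℂ) c)).congr ?_)
    filter_upwards [e.open_baseSet.mem_nhds hx] with y hy
    obtain ⟨φ, hφ⟩ := he y hy
    simpa [hφ] using (AlgHomClass.commutes φ c).symm
  star_mem' {s} hs := continuous_iff_continuousAt.2 fun x => by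
    obtain ⟨n, e, hx, he⟩ := M.exists_trivialization x
    have h1 := (continuousAt_section e hx s).1 (Continuous.continuousAt hs)
    refine (continuousAt_section e hx _).2 (h1.star.congr ?_)
    filter_upwards [e.open_baseSet.mem_nhds hx] with y hy
    obtain ⟨φ, hφ⟩ := he y hy
    simp [hφ, map_star]

/-- An action of `ℤ/k` on the matrix bundle `M`: an action on every fibre by `*`-automorphisms such
that every group element acts continuously on the total space. -/
structure Action (k : ℕ) where
  act : ∀ x, Multiplicative (ZMod k) →* (M.Fiber x ≃⋆ₐ[ℂ] M.Fiber x)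
  continuous_act : ∀ g, Continuous fun p : M.Total => (⟨p.proj, act p.proj g p.snd⟩ : M.Total)

namespace Action

variable {M} {k : ℕ} (a : M.Action k)

theorem act_mem_sections (g : Multiplicative (ZMod k)) {s : ∀ x, M.Fiber x}
    (hs : s ∈ M.sections) : (fun x => a.act x g (s x)) ∈ M.sections :=
  (a.continuous_act g).comp (show Continuous fun x => (⟨x, s x⟩ : M.Total) from hs)

/-- The induced action on the section algebra `Γ(M)`, `(g ▷ s)(x) = g ▷ s(x)`. -/
def onSections : Multiplicative (ZMod k) →* (M.sections ≃⋆ₐ[ℂ] M.sections) where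
  toFun g :=
    { toFun := fun s => ⟨fun x => a.act x g (s.1 x), a.act_mem_sections g s.2⟩
      invFun := fun s => ⟨fun x => a.act x g⁻¹ (s.1 x), a.act_mem_sections g⁻¹ s.2⟩
      left_inv := fun s => Subtype.ext <| funext fun x => by
        have h : a.act x g⁻¹ * a.act x g = 1 := by rw [← map_mul]; simp
        exact congrArg (fun f : M.Fiber x ≃⋆ₐ[ℂ] M.Fiber x => f (s.1 x)) h
      right_inv := fun s => Subtype.ext <| funext fun x => by
        have h : a.act x g * a.act x g⁻¹ = 1 := by rw [← map_mul]; simp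
        exact congrArg (fun f : M.Fiber x ≃⋆ₐ[ℂ] M.Fiber x => f (s.1 x)) h
      map_mul' := fun s t => Subtype.ext <| funext fun x => map_mul (a.act x g) (s.1 x) (t.1 x)
      map_add' := fun s t => Subtype.ext <| funext fun x => map_add (a.act x g) (s.1 x) (t.1 x)
      map_star' := fun s => Subtype.ext <| funext fun x => map_star (a.act x g) (s.1 x)
      map_smul' := fun c s => Subtype.ext <| funext fun x => map_smul (a.act x g) c (s.1 x) }
  map_one' := by
    refine StarAlgEquiv.ext fun s => Subtype.ext <| funext fun x => ?_
    exact congrArg (fun f : M.Fiber x ≃⋆ₐ[ℂ] M.Fiber x => f (s.1 x)) (map_one (a.act x))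
  map_mul' g h := by
    refine StarAlgEquiv.ext fun s => Subtype.ext <| funext fun x => ?_
    exact congrArg (fun f : M.Fiber x ≃⋆ₐ[ℂ] M.Fiber x => f (s.1 x)) (map_mul (a.act x) g h)

/-- `v ∈ Mₓ` is a unitary with `vᵏ = 1` inducing the action on the fibre at `x`: the generator `1`
of `ℤ/k` acts by `b ↦ v b v*`. -/
def Induces (x : X) (v : M.Fiber x) : Prop :=
  v ∈ unitary (M.Fiber x) ∧ v ^ k = 1 ∧
    ∀ b : M.Fiber x, a.act x (Multiplicative.ofAdd 1) b = v * b * star v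

/-- Everything is trivial, with constant ranks, over the open set `W`: there are a trivialization
`M|_W ≅ W × Mₙ(ℂ)` of matrix bundles and a continuous unitary section `s` over `W` with `sᵏ = 1`
inducing the action over `W`, such that every eigenspace bundle
`{(x, w) ∈ W × ℂⁿ | s(x) w = μ w}` is a trivial vector bundle, i.e. has a continuous frame. -/
def IsTrivialOn (W : Set X) : Prop :=
  ∃ (n : ℕ) (e : M.Triv n) (s : ∀ x, M.Fiber x),
    e.baseSet = W ∧ e.IsStarAlg ∧
    ContinuousOn (fun x => (⟨x, s x⟩ : M.Total)) W ∧
    (∀ x ∈ W, a.Induces x (s x)) ∧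
    ∀ μ : ℂ, ∃ (d : ℕ) (b : Fin d → X → (Fin n → ℂ)),
      (∀ i, ContinuousOn (b i) W) ∧
      ∀ x ∈ W, LinearIndependent ℂ (fun i => b i x) ∧
        Submodule.span ℂ (Set.range fun i => b i x) =
          Module.End.eigenspace (Matrix.toLin' (e ⟨x, s x⟩).2) μ

/-- Triviality over `U` when the ranks of the bundles involved may vary: `U` is partitioned into
open (hence relatively clopen) sets over each of which everything is trivial of constant rank. -/
def IsClopenTrivialOn (U : Set X) : Prop :=
  ∃ 𝒲 : Set (Set X), (∀ W ∈ 𝒲, IsOpen W ∧ a.IsTrivialOn W) ∧ 𝒲.PairwiseDisjoint id ∧ ⋃₀ 𝒲 = U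

/-- The index of the action: the smallest `m` (or `∞`, if there is none) for which there is an
open cover `X = U₀ ∪ … ∪ Uₘ` with `M` trivial over each `Uᵢ`, the action inner over each `Uᵢ`,
induced by a unitary section `sᵢ` with `sᵢᵏ = 1`, and all eigenbundles of `sᵢ` trivial over
`Uᵢ`. -/
def index : ℕ∞ :=
  sInf {N : ℕ∞ | ∃ m : ℕ, N = m ∧ ∃ U : Fin (m + 1) → Set X,
    (∀ i, IsOpen (U i) ∧ a.IsClopenTrivialOn (U i)) ∧ ⋃ i, U i = Set.univ}

end Action

/-- An element `v` of the fibre at `x` has equidimensional `ζʲ`-eigenspaces with respect to the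
identification `φ` of the fibre with `Mₙ(ℂ)`. -/
def EquidimEigenspaces {M : MatrixBundle X} {x : X} {n : ℕ}
    (φ : M.Fiber x ≃⋆ₐ[ℂ] Matrix (Fin n) (Fin n) ℂ) (ζ : ℂ) (v : M.Fiber x) : Prop :=
  ∀ i j : ℕ,
    Module.finrank ℂ (Module.End.eigenspace (Matrix.toLin' (φ v)) (ζ ^ i)) =
      Module.finrank ℂ (Module.End.eigenspace (Matrix.toLin' (φ v)) (ζ ^ j))

end MatrixBundle

end

noncomputable section

/-! ### Roots of unity and spectral projections -/

/-! Finite dimension forces equal eigenspaces: `ρ` sends the function √t·ζ^g to a normal element `h`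
which the generator multiplies by `ζ` and for which `star h * h` is the image of `t ⊗ 1`. In the
fibre at `x`, where the action is conjugation by `v`, this reads `v h = ζ h v`, so `h` moves the
`μ`-eigenspace of `v` into the `ζμ`-eigenspace. Since the elements `star h_j * h_j` add up to 1,
cyclicity of the trace shows that the spectral projections for `μ` and `ζμ` have the same trace
(`finrank_eigenspace_shift`, `equidimEigenspaces_of_ltDim_lt_top`).

Conversely, suppose that all eigenspaces have the same dimension and are framed over an open set.
After orthonormalizing the frames, a cyclic permutation of the eigenspaces is a continuous unitary
`w` with `w ^ k = 1` on which the generator acts as multiplication by `ζ`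
(`exists_shift_of_eigenframes`). Its spectral projections `P_g` are permuted by the action, so a
bump function `τ` yields the equivariant homomorphism `f ↦ ∑ g, f(τ, g) P_g`. A partition of unity
subordinate to a cover that computes the index gives one homomorphism per open set, hence the bound
by the index (`ltDim_le_index`).

The index is finite for every action: near each point the action is implemented by a continuous
unitary of order dividing `k` with framed eigenspaces (`exists_isTrivialOn`), and `X` is compact.
Finally, two admissible unitaries in a nonzero fibre differ by a power of `ζ`, which only rotates
the list of eigenspaces, so (c) and (c') agree. -/

theorem geom_sum_of_pow_eq_one {k : ℕ} {z : ℂ} (hz : z ^ k = 1) :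
    ∑ j ∈ Finset.range k, z ^ j = if z = 1 then (k : ℂ) else 0 := by
  split_ifs with h
  · simp [h]
  · have := mul_geom_sum z k
    rw [hz, sub_self, mul_eq_zero, sub_eq_zero] at this
    exact this.resolve_left h

/-- The character `g ↦ ζ ^ g` of `ℤ/k`. -/
def rootChar {k : ℕ} (ζ : ℂ) (g : ZMod k) : ℂ := ζ ^ g.val

section rootChar

variable {k : ℕ} {ζ : ℂ} (hζ : IsPrimitiveRoot ζ k)
include hζ

theorem rootChar_natCast (m : ℕ) : rootChar ζ (m : ZMod k) = ζ ^ m := by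
  rw [rootChar, ZMod.val_natCast, ← pow_eq_pow_mod _ hζ.pow_eq_one]

theorem rootChar_pow (g : ZMod k) : rootChar ζ g ^ k = 1 := by
  rw [rootChar, ← pow_mul, mul_comm, pow_mul, hζ.pow_eq_one, one_pow]

theorem rootChar_one : rootChar ζ (1 : ZMod k) = ζ := by
  simpa using rootChar_natCast hζ 1

variable [NeZero k]

theorem rootChar_add (g h : ZMod k) : rootChar ζ (g + h) = rootChar ζ g * rootChar ζ h := by
  rw [← ZMod.natCast_zmod_val g, ← ZMod.natCast_zmod_val h, ← Nat.cast_add,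
    rootChar_natCast hζ, rootChar_natCast hζ, rootChar_natCast hζ, pow_add]

theorem rootChar_add_one (g : ZMod k) : rootChar ζ (g + 1) = ζ * rootChar ζ g := by
  rw [rootChar_add hζ, rootChar_one hζ, mul_comm]

theorem rootChar_ne_zero (g : ZMod k) : rootChar ζ g ≠ 0 :=
  pow_ne_zero _ (hζ.ne_zero (NeZero.ne k))

theorem rootChar_injective : Function.Injective (rootChar ζ : ZMod k → ℂ) := fun g h hgh =>
  ZMod.val_injective k (hζ.pow_inj (ZMod.val_lt g) (ZMod.val_lt h) hgh)

theorem norm_rootChar (g : ZMod k) : ‖rootChar ζ g‖ = 1 :=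
  Complex.norm_eq_one_of_pow_eq_one (rootChar_pow hζ g) (NeZero.ne k)

theorem star_rootChar_mul_self (g : ZMod k) : star (rootChar ζ g) * rootChar ζ g = 1 := by
  rw [Complex.star_def, ← Complex.normSq_eq_conj_mul_self, Complex.normSq_eq_norm_sq,
    norm_rootChar hζ]
  simp

/-- Orthogonality of characters: translating the summation variable by 1 multiplies the sum by `ζ⁻¹
^ j`, which differs from 1 when `0 < j < k`. -/
theorem sum_inv_rootChar_pow {j : ℕ} (hj : j < k) :
    ∑ g : ZMod k, (rootChar ζ g)⁻¹ ^ j = if j = 0 then (k : ℂ) else 0 := by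
  split_ifs with h
  · simp [h]
  · have h1 : ∑ g : ZMod k, (rootChar ζ g)⁻¹ ^ j =
        ζ⁻¹ ^ j * ∑ g : ZMod k, (rootChar ζ g)⁻¹ ^ j := by
      conv_lhs => rw [← Equiv.sum_comp (Equiv.addRight (1 : ZMod k))]
      simp only [Equiv.coe_addRight, rootChar_add_one hζ, mul_inv, mul_pow, Finset.mul_sum]
    have h2 : ζ⁻¹ ^ j ≠ 1 := by
      rw [inv_pow, ne_eq, inv_eq_one]
      exact hζ.pow_ne_one_of_pos_of_lt h hj
    by_contra h3
    exact h2 (mul_right_cancel₀ h3 (by rw [one_mul]; exact h1.symm))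

end rootChar

section rootProj

variable {A B : Type*} [Ring A] [Algebra ℂ A] [Ring B] [Algebra ℂ B]

/-- The projection onto the `μ`-eigenspace of an element `v` with `v ^ k = 1`, for `μ ^ k = 1`. -/
def rootProj (k : ℕ) (v : A) (μ : ℂ) : A :=
  (k : ℂ)⁻¹ • ∑ j ∈ Finset.range k, μ⁻¹ ^ j • v ^ j

theorem map_rootProj {F : Type*} [FunLike F A B] [AlgHomClass F ℂ A B] (φ : F) (k : ℕ) (v : A)
    (μ : ℂ) : φ (rootProj k v μ) = rootProj k (φ v) μ := by
  simp only [rootProj, map_smul, map_sum, map_pow]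

variable {k : ℕ} {v : A} {μ ν : ℂ}

theorem sum_range_shift {E : Type*} [AddCommGroup E] {k : ℕ} {f : ℕ → E} (hf : f k = f 0) :
    ∑ j ∈ Finset.range k, f (j + 1) = ∑ j ∈ Finset.range k, f j := by
  have h2 := Finset.sum_range_succ' f k
  rw [Finset.sum_range_succ, hf] at h2
  exact (add_right_cancel h2).symm

theorem mul_rootProj (hv : v ^ k = 1) (hμ : μ ^ k = 1) (hμ0 : μ ≠ 0) :
    v * rootProj k v μ = μ • rootProj k v μ := by
  rw [rootProj, mul_smul_comm, smul_comm μ]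
  congr 1
  conv_rhs => rw [← sum_range_shift (f := fun j => μ⁻¹ ^ j • v ^ j) (by simp [hv, hμ])]
  rw [Finset.mul_sum, Finset.smul_sum]
  refine Finset.sum_congr rfl fun j _ => ?_
  rw [smul_smul, mul_smul_comm, pow_succ' v, pow_succ', mul_inv_cancel_left₀ hμ0]

theorem pow_mul_of_mul_eq_smul {b : A} (h : v * b = ν • b) (j : ℕ) : v ^ j * b = ν ^ j • b := by
  induction j with
  | zero => simp
  | succ j ih => rw [pow_succ, mul_assoc, h, mul_smul_comm, ih, smul_smul, pow_succ']

/-- On an element with eigenvalue `ν`, the averaging sum becomes the geometric sum of `μ⁻¹ * ν`. -/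
theorem rootProj_mul_of_mul_eq_smul [NeZero k] (hμ : μ ^ k = 1) (hν : ν ^ k = 1) {b : A}
    (h : v * b = ν • b) : rootProj k v μ * b = if μ = ν then b else 0 := by
  have hμ0 : μ ≠ 0 := by rintro rfl; simp [NeZero.ne k] at hμ
  have h1 : rootProj k v μ * b = ((k : ℂ)⁻¹ * ∑ j ∈ Finset.range k, (μ⁻¹ * ν) ^ j) • b := by
    rw [rootProj, smul_mul_assoc, Finset.sum_mul, mul_smul, Finset.sum_smul]
    simp only [smul_mul_assoc, pow_mul_of_mul_eq_smul h, smul_smul, mul_pow]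
  rw [h1, geom_sum_of_pow_eq_one (by rw [mul_pow, inv_pow, hμ, hν]; simp)]
  by_cases hμν : μ = ν
  · subst hμν
    simp [hμ0, NeZero.ne k]
  · have : ¬ (μ⁻¹ * ν = 1) := by
      rw [inv_mul_eq_one₀ hμ0]
      exact hμν
    simp [hμν, this]

theorem sum_rootProj [NeZero k] {ζ : ℂ} (hζ : IsPrimitiveRoot ζ k) (v : A) :
    ∑ g : ZMod k, rootProj k v (rootChar ζ g) = 1 := by
  simp only [rootProj, ← Finset.smul_sum]
  rw [Finset.sum_comm]
  simp only [← Finset.sum_smul]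
  rw [Finset.sum_congr rfl fun j hj => by
    rw [sum_inv_rootChar_pow hζ (Finset.mem_range.1 hj)]]
  simp [ite_smul, NeZero.ne k]

theorem rootProj_mul_rootProj [NeZero k] {ζ : ℂ} (hζ : IsPrimitiveRoot ζ k) (hv : v ^ k = 1)
    (g h : ZMod k) : rootProj k v (rootChar ζ g) * rootProj k v (rootChar ζ h) =
      if g = h then rootProj k v (rootChar ζ h) else 0 := by
  rw [rootProj_mul_of_mul_eq_smul (rootChar_pow hζ g) (rootChar_pow hζ h)
    (mul_rootProj hv (rootChar_pow hζ h) (rootChar_ne_zero hζ h))]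
  simp only [(rootChar_injective hζ).eq_iff]

/-- Eigenspaces of a unitary for distinct eigenvalues are orthogonal, `star (P g) * P h = 0`.
Inserting `∑ P h = 1` gives `star (P g) = star (P g) * P g`, whose right side is self-adjoint. -/
theorem star_rootProj [StarRing A] [StarModule ℂ A] [NeZero k] {ζ : ℂ}
    (hζ : IsPrimitiveRoot ζ k) (hv : v ^ k = 1) (hu : v ∈ unitary A) (g : ZMod k) :
    star (rootProj k v (rootChar ζ g)) = rootProj k v (rootChar ζ g) := by
  set P : ZMod k → A := fun g => rootProj k v (rootChar ζ g) with hP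
  have hvP : ∀ g, v * P g = rootChar ζ g • P g := fun g =>
    mul_rootProj hv (rootChar_pow hζ g) (rootChar_ne_zero hζ g)
  have h1 : ∀ g, star v * P g = star (rootChar ζ g) • P g := fun g => by
    have h := congrArg (fun b => star (rootChar ζ g) • (star v * b)) (hvP g)
    simp only [← mul_assoc, (Unitary.mem_iff.1 hu).1, one_mul, mul_smul_comm, smul_smul,
      star_rootChar_mul_self hζ, one_smul] at h
    exact h.symm
  have h2 : ∀ g, star (P g) * v = rootChar ζ g • star (P g) := fun g => by
    have h := congrArg star (h1 g)
    simpa using h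
  have h3 : ∀ g h, g ≠ h → star (P g) * P h = 0 := fun g h hgh => by
    have h4 : rootChar ζ g • (star (P g) * P h) = rootChar ζ h • (star (P g) * P h) := by
      rw [← smul_mul_assoc, ← h2, mul_assoc, hvP, mul_smul_comm]
    have h5 : (rootChar ζ g - rootChar ζ h) • (star (P g) * P h) = 0 := by
      rw [sub_smul, h4, sub_self]
    refine (smul_eq_zero.1 h5).resolve_left (sub_ne_zero.2 fun h6 => hgh ?_)
    exact rootChar_injective hζ h6
  have h4 : star (P g) = star (P g) * P g := by
    conv_lhs => rw [← mul_one (star (P g)), ← sum_rootProj hζ v, Finset.mul_sum]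
    exact Finset.sum_eq_single g (fun h _ hh => h3 g h hh.symm) (by simp)
  change star (P g) = P g
  have h5 : star (star (P g)) = star (star (P g) * P g) := congrArg star h4
  rw [star_mul, star_star, ← h4] at h5
  exact h5.symm

end rootProj

/-! ### Dimensions of eigenspaces -/

section eigenspaces

variable {n k : ℕ} {S : Matrix (Fin n) (Fin n) ℂ}

theorem mem_eigenspace_toLin' {m : Type*} [Fintype m] [DecidableEq m] {S : Matrix m m ℂ} {μ : ℂ}
    {w : m → ℂ} :
    w ∈ Module.End.eigenspace (Matrix.toLin' S) μ ↔ S.mulVec w = μ • w := by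
  rw [Module.End.mem_eigenspace_iff, Matrix.toLin'_apply]

/-- The trace of a projection is its rank. Dimensions thereby become traces of polynomials in `S`,
to which cyclicity and invariance under isomorphisms apply. -/
theorem trace_rootProj [NeZero k] (hS : S ^ k = 1) {μ : ℂ} (hμ : μ ^ k = 1) :
    (rootProj k S μ).trace = Module.finrank ℂ (Module.End.eigenspace (Matrix.toLin' S) μ) := by
  have hμ0 : μ ≠ 0 := by rintro rfl; simp [NeZero.ne k] at hμ
  have hproj : LinearMap.IsProj (Module.End.eigenspace (Matrix.toLin' S) μ)
      (Matrix.toLin' (rootProj k S μ)) := by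
    constructor
    · intro w
      rw [mem_eigenspace_toLin', Matrix.toLin'_apply, Matrix.mulVec_mulVec,
        mul_rootProj hS hμ hμ0, Matrix.smul_mulVec]
    · intro w hw
      rw [mem_eigenspace_toLin'] at hw
      -- Repeating `w` in every column makes it an element of the matrix algebra itself, where the
      -- preceding algebraic lemma applies.
      have h1 : S * Matrix.replicateCol (Fin n) w = μ • Matrix.replicateCol (Fin n) w := by
        ext p q
        exact congrFun hw p
      have h2 := rootProj_mul_of_mul_eq_smul hμ hμ h1
      rw [if_pos rfl] at h2
      ext p
      exact congrFun (congrFun h2 p) p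
  rw [← hproj.trace, Matrix.trace_toLin'_eq]

theorem sum_finrank_eigenspace [NeZero k] {ζ : ℂ} (hζ : IsPrimitiveRoot ζ k) (hS : S ^ k = 1) :
    ∑ g : ZMod k, Module.finrank ℂ (Module.End.eigenspace (Matrix.toLin' S) (rootChar ζ g)) =
      n := by
  have h := congrArg Matrix.trace (sum_rootProj hζ S)
  rw [Matrix.trace_sum, Matrix.trace_one, Fintype.card_fin,
    Finset.sum_congr rfl fun g _ => trace_rootProj hS (rootChar_pow hζ g)] at h
  exact_mod_cast h

/-- If `1 = ∑ Kⱼ Hⱼ` where `Kⱼ` commutes with `Hⱼ` and `Hⱼ` shifts the eigenvalues of `S` by `ζ`,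
then the dimensions of the eigenspaces are invariant under this shift. -/
theorem finrank_eigenspace_shift [NeZero k] {ζ : ℂ} (hζ : ζ ^ k = 1) (hS : S ^ k = 1)
    {ι : Type*} [Fintype ι] (H K : ι → Matrix (Fin n) (Fin n) ℂ)
    (hSH : ∀ j, S * H j = ζ • (H j * S)) (hHK : ∀ j, H j * K j = K j * H j)
    (hsum : ∑ j, K j * H j = 1) {μ : ℂ} (hμ : μ ^ k = 1) :
    Module.finrank ℂ (Module.End.eigenspace (Matrix.toLin' S) (ζ * μ)) =
      Module.finrank ℂ (Module.End.eigenspace (Matrix.toLin' S) μ) := by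
  have hζ0 : ζ ≠ 0 := by rintro rfl; simp [NeZero.ne k] at hζ
  have hpow : ∀ j (i : ℕ), H j * S ^ i = ζ⁻¹ ^ i • (S ^ i * H j) := fun j i => by
    induction i with
    | zero => simp
    | succ i ih =>
      have h1 : H j * S = ζ⁻¹ • (S * H j) := by rw [hSH, smul_smul, inv_mul_cancel₀ hζ0, one_smul]
      rw [pow_succ, ← mul_assoc, ih, smul_mul_assoc, mul_assoc, h1, mul_smul_comm, smul_smul,
        ← mul_assoc, ← pow_succ, ← pow_succ]
  have hP : ∀ j, rootProj k S (ζ * μ) * H j = H j * rootProj k S μ := fun j => by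
    rw [rootProj, rootProj, smul_mul_assoc, mul_smul_comm, Finset.mul_sum, Finset.sum_mul]
    congr 1
    refine Finset.sum_congr rfl fun i _ => ?_
    rw [smul_mul_assoc, mul_smul_comm, hpow, smul_smul, mul_inv, mul_pow, mul_comm (ζ⁻¹ ^ i)]
  -- With `P'` and `P` the two projections, tr(P'KH) = tr(P'HK) = tr(HPK) = tr(PKH) for each `j`.
  have h : (rootProj k S (ζ * μ)).trace = (rootProj k S μ).trace := by
    rw [← mul_one (rootProj k S (ζ * μ)), ← mul_one (rootProj k S μ), ← hsum, Finset.mul_sum,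
      Finset.mul_sum, Matrix.trace_sum, Matrix.trace_sum]
    refine Finset.sum_congr rfl fun j _ => ?_
    rw [← hHK, ← mul_assoc, hP, hHK, ← mul_assoc, Matrix.trace_mul_comm, ← mul_assoc,
      Matrix.trace_mul_cycle]
  rw [trace_rootProj hS (by rw [mul_pow, hζ, hμ, one_mul]), trace_rootProj hS hμ] at h
  exact_mod_cast h

theorem rootProj_smul {A : Type*} [Ring A] [Algebra ℂ A] (c : ℂ) (v : A) (μ : ℂ) :
    rootProj k (c • v) μ = rootProj k v (c⁻¹ * μ) := by
  simp only [rootProj, smul_pow, smul_smul, mul_inv, mul_pow, inv_inv, mul_comm]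

/-- The dimensions of the eigenspaces do not depend on the identification with a matrix algebra. -/
theorem finrank_eigenspace_algEquiv [NeZero k] {A : Type*} [Ring A] [Algebra ℂ A] {m : ℕ}
    (φ : A ≃ₐ[ℂ] Matrix (Fin n) (Fin n) ℂ) (ψ : A ≃ₐ[ℂ] Matrix (Fin m) (Fin m) ℂ) {v : A}
    (hv : v ^ k = 1) {μ : ℂ} (hμ : μ ^ k = 1) {c : ℂ} (hc : c ^ k = 1) :
    Module.finrank ℂ (Module.End.eigenspace (Matrix.toLin' (φ (c • v))) μ) =
      Module.finrank ℂ (Module.End.eigenspace (Matrix.toLin' (ψ v)) (c⁻¹ * μ)) := by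
  have hnm : n = m := by
    have h := (φ.symm.trans ψ).toLinearEquiv.finrank_eq
    simp only [Module.finrank_matrix, Fintype.card_fin, Module.finrank_self, mul_one] at h
    exact Nat.mul_self_inj.1 h
  subst hnm
  have h1 := trace_rootProj (S := φ (c • v)) (by rw [← map_pow, smul_pow, hc, hv]; simp) hμ
  have h2 := trace_rootProj (S := ψ v) (μ := c⁻¹ * μ) (by rw [← map_pow, hv, map_one])
    (by rw [mul_pow, inv_pow, hc, hμ]; simp)
  rw [← map_rootProj] at h1 h2
  rw [rootProj_smul] at h1
  -- Isomorphisms of matrix algebras preserve the trace.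
  have h3 := Matrix.trace_map' (φ.symm.trans ψ) (φ (rootProj k v (c⁻¹ * μ)))
  simp only [AlgEquiv.trans_apply, AlgEquiv.symm_apply_apply] at h3
  rw [h2, h1] at h3
  exact_mod_cast h3.symm

end eigenspaces

/-! ### The action on a fibre -/

namespace MatrixBundle

variable {X : Type*} [TopologicalSpace X] {M : MatrixBundle X} {k : ℕ} {a : M.Action k}

theorem exists_fiber_equiv (M : MatrixBundle X) (x : X) :
    ∃ n : ℕ, Nonempty (M.Fiber x ≃⋆ₐ[ℂ] Matrix (Fin n) (Fin n) ℂ) := by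
  obtain ⟨n, e, hx, he⟩ := M.exists_trivialization x
  obtain ⟨φ, -⟩ := he x hx
  exact ⟨n, ⟨φ⟩⟩

theorem equidimEigenspaces_zero {x : X} (φ : M.Fiber x ≃⋆ₐ[ℂ] Matrix (Fin 0) (Fin 0) ℂ) (ζ : ℂ)
    (v : M.Fiber x) : EquidimEigenspaces φ ζ v := fun i j => by
  rw [Module.finrank_zero_of_subsingleton, Module.finrank_zero_of_subsingleton]

theorem exists_eq_smul_one_of_commute {n : ℕ} {A : Matrix (Fin n) (Fin n) ℂ}
    (hA : ∀ B, B * A = A * B) : ∃ c : ℂ, A = c • 1 := by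
  have h : A ∈ Set.center (Matrix (Fin n) (Fin n) ℂ) := Semigroup.mem_center_iff.2 hA
  rw [Matrix.center_eq_range] at h
  obtain ⟨c, hc⟩ := h
  exact ⟨c, by rw [← hc, Matrix.smul_one_eq_diagonal]; rfl⟩

namespace Action.Induces

variable {x : X} {v v' : M.Fiber x}

theorem act_one (hv : a.Induces x v) (b : M.Fiber x) :
    a.act x (Multiplicative.ofAdd 1) b = v * b * star v := hv.2.2 b

/-- Two unitaries inducing the action differ by a scalar. -/
theorem exists_eq_smul (hv : a.Induces x v) (hv' : a.Induces x v') :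
    ∃ c : ℂ, v = c • v' := by
  obtain ⟨n, ⟨φ⟩⟩ := M.exists_fiber_equiv x
  have h1 := Unitary.mem_iff.1 hv.1
  have h1' := Unitary.mem_iff.1 hv'.1
  -- Both unitaries induce the same automorphism, so `star v' * v` is central, hence scalar.
  have hcomm : ∀ b, b * (star v' * v) = star v' * v * b := fun b => by
    have h2 : v * b * star v = v' * b * star v' := by rw [← hv.act_one, hv'.act_one]
    calc b * (star v' * v) = star v' * (v' * b * star v') * v := by
          simp only [← mul_assoc, h1'.1, one_mul]
      _ = star v' * v * b := by
          rw [← h2]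
          simp only [mul_assoc, h1.1, mul_one]
  obtain ⟨c, hc⟩ := exists_eq_smul_one_of_commute (A := φ (star v' * v)) fun B => by
    rw [← φ.apply_symm_apply B, ← map_mul, hcomm, map_mul]
  refine ⟨c, ?_⟩
  have h3 : star v' * v = c • 1 := EquivLike.injective φ (by rw [hc, map_smul, map_one])
  calc v = v' * (star v' * v) := by rw [← mul_assoc, h1'.2, one_mul]
    _ = c • v' := by rw [h3, mul_smul_comm, mul_one]

/-- Nontriviality matters: in a zero fibre (`n = 0`) any scalar `c` satisfies `hc`. -/
theorem pow_scalar_eq_one [Nontrivial (M.Fiber x)] (hv : a.Induces x v) (hv' : a.Induces x v')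
    {c : ℂ} (hc : v = c • v') : c ^ k = 1 := by
  have h := hv.2.1
  rw [hc, smul_pow, hv'.2.1, ← sub_eq_zero] at h
  nth_rw 2 [← one_smul ℂ (1 : M.Fiber x)] at h
  rw [← sub_smul, smul_eq_zero] at h
  exact sub_eq_zero.1 (h.resolve_right one_ne_zero)

/-- With `v = ζ ^ l • v'`, the `ζ ^ i`-eigenspace of `v'` corresponds to the `ζ ^ (l +
i)`-eigenspace of `v`; equality of all dimensions survives this rotation. -/
theorem equidimEigenspaces [NeZero k] {ζ : ℂ} (hζ : IsPrimitiveRoot ζ k) {n m : ℕ}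
    {φ : M.Fiber x ≃⋆ₐ[ℂ] Matrix (Fin n) (Fin n) ℂ}
    (ψ : M.Fiber x ≃⋆ₐ[ℂ] Matrix (Fin m) (Fin m) ℂ)
    (hv : a.Induces x v) (hv' : a.Induces x v') (h : EquidimEigenspaces φ ζ v) :
    EquidimEigenspaces ψ ζ v' := by
  obtain rfl | hm := Nat.eq_zero_or_pos m
  · exact equidimEigenspaces_zero ψ ζ v'
  have : Nonempty (Fin m) := ⟨⟨0, hm⟩⟩
  have : Nontrivial (M.Fiber x) := ψ.toEquiv.nontrivial
  obtain ⟨c, hc⟩ := hv.exists_eq_smul hv'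
  have hck := hv.pow_scalar_eq_one hv' hc
  obtain ⟨l, -, rfl⟩ := hζ.eq_pow_of_pow_eq_one hck
  have hζ0 : ζ ≠ 0 := hζ.ne_zero (NeZero.ne k)
  have key : ∀ i : ℕ, Module.finrank ℂ (Module.End.eigenspace (Matrix.toLin' (ψ v')) (ζ ^ i)) =
      Module.finrank ℂ (Module.End.eigenspace (Matrix.toLin' (φ v)) (ζ ^ (l + i))) := fun i => by
    have hpow : ∀ r : ℕ, (ζ ^ r) ^ k = 1 := fun r => by
      rw [← pow_mul, mul_comm, pow_mul, hζ.pow_eq_one, one_pow]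
    have h1 := finrank_eigenspace_algEquiv (AlgEquivClass.toAlgEquiv φ : M.Fiber x ≃ₐ[ℂ] _)
      (AlgEquivClass.toAlgEquiv ψ : M.Fiber x ≃ₐ[ℂ] _) hv'.2.1 (hpow (l + i)) hck
    rw [pow_add, inv_mul_cancel_left₀ (pow_ne_zero _ hζ0), ← hc, ← pow_add] at h1
    exact h1.symm
  intro i j
  rw [key, key, h]

end Action.Induces

end MatrixBundle

/-! ### Finite local-triviality dimension forces equidimensional eigenspaces -/

theorem coneCoordinate_apply (G : Type*) [TopologicalSpace G] [CompactSpace G]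
    (p : Set.Ioc (0 : ℝ) 1 × G) : coneCoordinate G p = ((p.1 : ℝ) : ℂ) := rfl

/-- The function `(t, g) ↦ √t ζ ^ g`. -/
def coneRoot (k : ℕ) [NeZero k] (ζ : ℂ) : C₀(Set.Ioc (0 : ℝ) 1 × Multiplicative (ZMod k), ℂ) where
  toFun p := (Real.sqrt p.1 : ℂ) * rootChar ζ p.2.toAdd
  continuous_toFun := by
    have h : Continuous fun g : Multiplicative (ZMod k) => rootChar ζ g.toAdd :=
      continuous_of_discreteTopology
    fun_prop
  zero_at_infty' := by
    have h := (coneCoordinate (Multiplicative (ZMod k))).zero_at_infty'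
    -- Here `ζ` is an arbitrary complex number, so its powers are bounded only by finiteness of
    -- `ℤ/k`.
    obtain ⟨C, hC⟩ := (Set.finite_range fun g : ZMod k => ‖rootChar ζ g‖).bddAbove
    rw [tendsto_zero_iff_norm_tendsto_zero] at h ⊢
    have h2 := (Real.continuous_sqrt.tendsto 0).comp h
    rw [Real.sqrt_zero] at h2
    have h3 := h2.mul_const C
    rw [zero_mul] at h3
    refine squeeze_zero (fun _ => norm_nonneg _) (fun p => ?_) h3
    have h4 : ‖rootChar ζ p.2.toAdd‖ ≤ C := hC ⟨_, rfl⟩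
    have h5 : ‖(coneCoordinate (Multiplicative (ZMod k))).toFun p‖ = p.1 := by
      change ‖((p.1 : ℝ) : ℂ)‖ = p.1
      rw [Complex.norm_real, Real.norm_of_nonneg p.1.2.1.le]
    rw [norm_mul, Complex.norm_real, Real.norm_of_nonneg (Real.sqrt_nonneg _)]
    simp only [Function.comp_apply, h5]
    gcongr

section coneRoot

variable {k : ℕ} [NeZero k] {ζ : ℂ}

theorem coneRoot_apply (p : Set.Ioc (0 : ℝ) 1 × Multiplicative (ZMod k)) :
    coneRoot k ζ p = (Real.sqrt p.1 : ℂ) * rootChar ζ p.2.toAdd := rfl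

theorem star_coneRoot_mul_self (hζ : IsPrimitiveRoot ζ k) :
    star (coneRoot k ζ) * coneRoot k ζ = coneCoordinate (Multiplicative (ZMod k)) := by
  ext p
  rw [ZeroAtInftyContinuousMap.mul_apply, ZeroAtInftyContinuousMap.star_apply, coneRoot_apply,
    coneCoordinate_apply, star_mul', mul_mul_mul_comm, star_rootChar_mul_self hζ, mul_one,
    Complex.star_def, Complex.conj_ofReal, ← Complex.ofReal_mul,
    Real.mul_self_sqrt p.1.2.1.le]

theorem coneTranslate_coneRoot (hζ : IsPrimitiveRoot ζ k) :
    coneTranslate (Multiplicative.ofAdd 1) (coneRoot k ζ) = ζ • coneRoot k ζ := by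
  ext p
  rw [ZeroAtInftyContinuousMap.smul_apply, coneRoot_apply]
  change (Real.sqrt p.1 : ℂ) * rootChar ζ (p.2.toAdd + 1) = _
  rw [rootChar_add_one hζ, smul_eq_mul]
  ring

end coneRoot

/-- The images `h j` of `coneRoot` in the fibre are normal, because the cone algebra is commutative,
and satisfy `v * h j = ζ • (h j * v)`. They feed `finrank_eigenspace_shift` with `K j = star (h j)`,
and induction runs through all powers of `ζ`. -/
theorem MatrixBundle.equidimEigenspaces_of_ltDim_lt_top {X : Type*} [TopologicalSpace X] {k : ℕ}
    [NeZero k] {ζ : ℂ} (hζ : IsPrimitiveRoot ζ k) {M : MatrixBundle X} {a : M.Action k}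
    (hfin : ltDim a.onSections < ⊤) {x : X} {n : ℕ}
    (φ : M.Fiber x ≃⋆ₐ[ℂ] Matrix (Fin n) (Fin n) ℂ) {v : M.Fiber x} (hv : a.Induces x v) :
    EquidimEigenspaces φ ζ v := by
  obtain ⟨_, ⟨N, rfl, ρ, hρ, hsum⟩, -⟩ := sInf_lt_iff.1 hfin
  have h1 := Unitary.mem_iff.1 hv.1
  let h : Fin (N + 1) → M.Fiber x := fun j => (ρ j (coneRoot k ζ)).1 x
  have hstar : ∀ j, star (h j) * h j = (ρ j (coneCoordinate _)).1 x := fun j => by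
    rw [← star_coneRoot_mul_self hζ, map_mul, map_star]
    rfl
  have hcomm : ∀ j, h j * star (h j) = star (h j) * h j := fun j => by
    rw [hstar, ← star_coneRoot_mul_self hζ, mul_comm, map_mul, map_star]
    rfl
  have hshift : ∀ j, v * h j = ζ • (h j * v) := fun j => by
    have h2 : v * h j * star v = ζ • h j := by
      rw [← hv.act_one]
      have h3 := hρ j (Multiplicative.ofAdd 1) (coneRoot k ζ)
      rw [coneTranslate_coneRoot hζ, map_smul] at h3
      exact congrArg (fun s : M.sections => s.1 x) h3
    rw [← smul_mul_assoc, ← h2, mul_assoc _ (star v), h1.1, mul_one]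
  have hone : ∑ j, star (h j) * h j = 1 := by
    have h2 := congrArg (fun s : M.sections => s.1 x) hsum
    simp only [AddSubmonoidClass.coe_finsetSum, Finset.sum_apply] at h2
    rw [Finset.sum_congr rfl fun j _ => hstar j]
    exact h2
  have hk : φ v ^ k = 1 := by rw [← map_pow, hv.2.1, map_one]
  have key : ∀ i : ℕ, Module.finrank ℂ (Module.End.eigenspace (Matrix.toLin' (φ v)) (ζ ^ i)) =
      Module.finrank ℂ (Module.End.eigenspace (Matrix.toLin' (φ v)) 1) := fun i => by
    induction i with
    | zero => rw [pow_zero]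
    | succ i ih =>
      rw [← ih, pow_succ']
      refine finrank_eigenspace_shift hζ.pow_eq_one hk (fun j => φ (h j)) (fun j => φ (star (h j)))
        (fun j => ?_) (fun j => ?_) ?_ ?_
      · rw [← map_mul, hshift, map_smul, map_mul]
      · rw [← map_mul, hcomm, map_mul]
      · simp only [← map_mul]
        rw [← map_sum, hone, map_one]
      · rw [← pow_mul, mul_comm, pow_mul, hζ.pow_eq_one, one_pow]
  intro i j
  rw [key, key]

/-! ### Actions on matrix bundles are locally trivial -/

section LocalUnitary

variable {Y : Type*} [TopologicalSpace Y] {n k : ℕ}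

/-- A `*`-automorphism of a matrix algebra is implemented by a multiple of a unitary which is given
by an explicit formula. -/
theorem Matrix.starAlgEquiv_intertwiner
    (α : Matrix (Fin n) (Fin n) ℂ ≃⋆ₐ[ℂ] Matrix (Fin n) (Fin n) ℂ)
    (p l : Fin n) (u : Matrix (Fin n) (Fin n) ℂ)
    (hu : u = ∑ i, α (Matrix.single i p 1) * Matrix.single l i 1) :
    (∀ b, α b * u = u * b) ∧
      star u * u = ((∑ i, ‖α (Matrix.single p p 1) i l‖ ^ 2 : ℝ) : ℂ) • 1 := by
  constructor
  · intro b
    have h1 : ∀ i, b * Matrix.single i p 1 = ∑ j, b j i • Matrix.single j p (1 : ℂ) := fun i => by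
      ext r c
      simp [Matrix.sum_apply, Matrix.mul_apply, Matrix.single_apply, ite_and]
    have h2 : ∀ j, Matrix.single l j 1 * b = ∑ i, b j i • Matrix.single l i (1 : ℂ) := fun j => by
      ext r c
      simp [Matrix.sum_apply, Matrix.mul_apply, Matrix.single_apply, ite_and]
    rw [hu, Finset.mul_sum, Finset.sum_mul]
    simp only [← mul_assoc, ← map_mul, h1]
    simp only [mul_assoc, h2, map_sum, map_smul, Finset.sum_mul, Finset.mul_sum, smul_mul_assoc,
      mul_smul_comm]
    rw [Finset.sum_comm]
  · have hA : star (α (Matrix.single p p 1)) * α (Matrix.single p p 1) =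
        α (Matrix.single p p 1) := by
      rw [← map_star, ← map_mul, Matrix.star_eq_conjTranspose, Matrix.conjTranspose_single]
      simp
    -- A diagonal entry of a self-adjoint projection is the squared norm of its column.
    have hc : α (Matrix.single p p 1) l l =
        ((∑ i, ‖α (Matrix.single p p 1) i l‖ ^ 2 : ℝ) : ℂ) := by
      conv_lhs => rw [← hA]
      rw [Matrix.mul_apply]
      push_cast
      refine Finset.sum_congr rfl fun i _ => ?_
      rw [Matrix.star_apply, Complex.star_def, Complex.conj_mul']
    rw [← hc, hu, star_sum, Finset.sum_mul_sum]
    -- Cross terms contain `α (e_pi * e_jp) = 0`; each diagonal term cuts out the `(l, l)` entry of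
    -- `α (e_pp)`.
    have h1 : ∀ i j, star (α (Matrix.single i p 1) * Matrix.single l i 1) *
        (α (Matrix.single j p 1) * Matrix.single l j 1) =
        if i = j then α (Matrix.single p p 1) l l • Matrix.single i i 1 else 0 := fun i j => by
      have h2 : star (α (Matrix.single i p 1) * Matrix.single l i 1) *
          (α (Matrix.single j p 1) * Matrix.single l j 1) =
          Matrix.single i l 1 * α (Matrix.single p i 1 * Matrix.single j p 1) *
            Matrix.single l j 1 := by
        rw [star_mul, ← map_star, Matrix.star_eq_conjTranspose, Matrix.star_eq_conjTranspose,
          Matrix.conjTranspose_single, Matrix.conjTranspose_single, star_one, map_mul]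
        simp only [mul_assoc]
      rw [h2]
      split_ifs with hij
      · subst hij
        rw [Matrix.single_mul_single_same]
        ext r c
        simp [Matrix.mul_apply, Matrix.single_apply, ite_and]
        split_ifs <;> rfl
      · rw [Matrix.single_mul_single_of_ne _ _ _ _ hij]
        simp
    simp only [h1, Finset.sum_ite_eq, Finset.mem_univ, if_true, ← Finset.smul_sum]
    congr 1
    ext r c
    simp [Matrix.sum_apply, Matrix.single_apply, Matrix.one_apply, ite_and]

/-- The explicit intertwiner depends continuously on `y` and satisfies `star u * u = r • 1`.
Choosing `l` as a nonzero column of `α x₀ (e_pp)` makes `r` positive near `x₀`, where dividing by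
`√r` gives a unitary. -/
theorem exists_local_unitary {W : Set Y} (hW : IsOpen W) {x₀ : Y} (hx₀ : x₀ ∈ W)
    (α : Y → (Matrix (Fin n) (Fin n) ℂ ≃⋆ₐ[ℂ] Matrix (Fin n) (Fin n) ℂ))
    (hα : ∀ b, ContinuousOn (fun y => α y b) W) :
    ∃ W' ⊆ W, IsOpen W' ∧ x₀ ∈ W' ∧ ∃ u : Y → Matrix (Fin n) (Fin n) ℂ, ContinuousOn u W' ∧
      ∀ y ∈ W', u y ∈ unitary (Matrix (Fin n) (Fin n) ℂ) ∧ ∀ b, α y b = u y * b * star (u y) := by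
  obtain rfl | hn := Nat.eq_zero_or_pos n
  · exact ⟨W, subset_rfl, hW, hx₀, fun _ => 1, continuousOn_const,
      fun y _ => ⟨one_mem _, fun b => Subsingleton.elim _ _⟩⟩
  let p : Fin n := ⟨0, hn⟩
  obtain ⟨q, l, hql⟩ : ∃ q l, α x₀ (Matrix.single p p 1) q l ≠ 0 := by
    by_contra! h
    have h1 : α x₀ (Matrix.single p p 1) = 0 := Matrix.ext h
    rw [map_eq_zero_iff _ (EquivLike.injective _)] at h1
    simpa using congrFun (congrFun h1 p) p
  set r : Y → ℝ := fun y => ∑ i, ‖α y (Matrix.single p p 1) i l‖ ^ 2 with hr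
  have hrc : ContinuousOn r W := continuousOn_finsetSum _ fun i _ =>
    (((continuous_id.matrix_elem i l).comp_continuousOn (hα _)).norm).pow 2
  set u : Y → Matrix (Fin n) (Fin n) ℂ :=
    fun y => ∑ i, α y (Matrix.single i p 1) * Matrix.single l i 1 with hu
  have huc : ContinuousOn u W := continuousOn_finsetSum _ fun i _ =>
    (hα _).mul continuousOn_const
  refine ⟨W ∩ r ⁻¹' Set.Ioi 0, Set.inter_subset_left, hrc.isOpen_inter_preimage hW isOpen_Ioi,
    ⟨hx₀, ?_⟩, fun y => ((Real.sqrt (r y))⁻¹ : ℂ) • u y, ?_, ?_⟩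
  · change 0 < ∑ i, ‖α x₀ (Matrix.single p p 1) i l‖ ^ 2
    exact Finset.sum_pos' (fun i _ => sq_nonneg _)
      ⟨q, Finset.mem_univ _, pow_pos (norm_pos_iff.2 hql) 2⟩
  · have h : ContinuousOn (fun y => ((Real.sqrt (r y))⁻¹ : ℂ)) (W ∩ r ⁻¹' Set.Ioi 0) := ?_
    · exact h.smul (huc.mono Set.inter_subset_left)
    refine ContinuousOn.inv₀ ?_ ?_
    · exact (Complex.continuous_ofReal.comp Real.continuous_sqrt).comp_continuousOn
        (hrc.mono Set.inter_subset_left)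
    · intro y hy
      exact_mod_cast (Real.sqrt_pos.2 hy.2).ne'
  · intro y hy
    obtain ⟨h1, h2⟩ := Matrix.starAlgEquiv_intertwiner (α y) p l (u y) rfl
    have hpos : 0 < Real.sqrt (r y) := Real.sqrt_pos.2 hy.2
    set c : ℂ := ((Real.sqrt (r y))⁻¹ : ℂ) with hc
    have hcc : star c * c * (r y : ℂ) = 1 := by
      have h3 : (Real.sqrt (r y) : ℂ) ≠ 0 := by exact_mod_cast hpos.ne'
      have h4 : (r y : ℂ) = (Real.sqrt (r y) : ℂ) * Real.sqrt (r y) := by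
        exact_mod_cast (Real.mul_self_sqrt (le_of_lt hy.2)).symm
      have h5 : star c = c := by
        rw [hc, ← Complex.ofReal_inv, Complex.star_def, Complex.conj_ofReal]
      rw [h5, h4, hc]
      field_simp
    have h3 : star (c • u y) * (c • u y) = 1 := by
      rw [star_smul, smul_mul_smul_comm, h2, smul_smul, hcc, one_smul]
    have h4 : (c • u y) * star (c • u y) = 1 := mul_eq_one_comm.1 h3
    refine ⟨Unitary.mem_iff.2 ⟨h3, h4⟩, fun b => ?_⟩
    rw [smul_mul_assoc, ← h1, ← mul_smul_comm, mul_assoc, h4, mul_one]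

/-- As `α ^ k = 1`, the power `u ^ k` is a scalar `c` of modulus 1. It remains to divide `u` by a
continuous `k`-th root of `c`: a fixed root of `c x₀` times the principal root of `c / c x₀`, which
stays in the slit plane near `x₀`. -/
theorem exists_local_unitary_pow_eq_one [NeZero k] {W : Set Y} (hW : IsOpen W) {x₀ : Y}
    (hx₀ : x₀ ∈ W) (α : Y → (Matrix (Fin n) (Fin n) ℂ ≃⋆ₐ[ℂ] Matrix (Fin n) (Fin n) ℂ))
    (hα : ∀ b, ContinuousOn (fun y => α y b) W) (hαk : ∀ y ∈ W, ∀ b, (α y)^[k] b = b) :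
    ∃ W' ⊆ W, IsOpen W' ∧ x₀ ∈ W' ∧ ∃ s : Y → Matrix (Fin n) (Fin n) ℂ, ContinuousOn s W' ∧
      ∀ y ∈ W', s y ∈ unitary (Matrix (Fin n) (Fin n) ℂ) ∧ s y ^ k = 1 ∧
        ∀ b, α y b = s y * b * star (s y) := by
  obtain ⟨W', hW', hWo, hxW, u, huc, hu⟩ := exists_local_unitary hW hx₀ α hα
  obtain rfl | hn := Nat.eq_zero_or_pos n
  · exact ⟨W', hW', hWo, hxW, u, huc, fun y hy => ⟨(hu y hy).1, Subsingleton.elim _ _, (hu y hy).2⟩⟩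
  let p : Fin n := ⟨0, hn⟩
  set c : Y → ℂ := fun y => (u y ^ k) p p with hc
  have hcc : ContinuousOn c W' := (continuous_id.matrix_elem p p).comp_continuousOn (huc.pow k)
  have hcu : ∀ y ∈ W', u y ^ k = c y • 1 := fun y hy => by
    have h1 := Unitary.mem_iff.1 (hu y hy).1
    have h2 : ∀ (j : ℕ) b, (α y)^[j] b * u y ^ j = u y ^ j * b := fun j b => by
      induction j with
      | zero => simp
      | succ j ih =>
        rw [Function.iterate_succ_apply', (hu y hy).2, pow_succ', mul_assoc, ← mul_assoc (star _),
          h1.1, one_mul, mul_assoc, ih, mul_assoc]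
    obtain ⟨d, hd⟩ := MatrixBundle.exists_eq_smul_one_of_commute (A := u y ^ k) fun b => by
      rw [← h2 k b, hαk y (hW' hy)]
    have : c y = d := by simp [hc, hd]
    rw [this, hd]
  have hcn : ∀ y ∈ W', ‖c y‖ = 1 := fun y hy => by
    have h1 := Unitary.mem_iff.1 (pow_mem (hu y hy).1 k)
    rw [hcu y hy, star_smul, smul_mul_smul_comm] at h1
    have h2 := congrFun (congrFun h1.1 p) p
    simp only [star_one, mul_one, Matrix.smul_apply, Matrix.one_apply_eq, smul_eq_mul,
      Complex.star_def, Complex.conj_mul'] at h2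
    have h3 : ‖c y‖ ^ 2 = 1 := by exact_mod_cast h2
    exact (pow_eq_one_iff_of_nonneg (norm_nonneg _) two_ne_zero).1 h3
  have hc0 : c x₀ ≠ 0 := norm_ne_zero_iff.1 (by rw [hcn x₀ hxW]; exact one_ne_zero)
  obtain ⟨r₀, hr₀⟩ := IsAlgClosed.exists_pow_nat_eq (c x₀) (NeZero.pos k)
  have hqc : ContinuousOn (fun y => c y / c x₀) W' := hcc.div_const _
  refine ⟨W' ∩ (fun y => c y / c x₀) ⁻¹' Complex.slitPlane, Set.inter_subset_left.trans hW',
    hqc.isOpen_inter_preimage hWo Complex.isOpen_slitPlane, ⟨hxW, by simp [hc0]⟩, ?_⟩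
  set r : Y → ℂ := fun y => r₀ * (c y / c x₀) ^ ((k : ℂ)⁻¹) with hr
  have hrk : ∀ y, r y ^ k = c y := fun y => by
    rw [hr, mul_pow, hr₀, Complex.cpow_nat_inv_pow _ (NeZero.ne k), mul_div_cancel₀ _ hc0]
  have hrn : ∀ y ∈ W', ‖r y‖ = 1 := fun y hy => by
    have h1 : ‖r y‖ ^ k = 1 := by rw [← norm_pow, hrk, hcn y hy]
    exact (pow_eq_one_iff_of_nonneg (norm_nonneg _) (NeZero.ne k)).1 h1
  have hr0 : ∀ y ∈ W', r y ≠ 0 := fun y hy =>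
    norm_ne_zero_iff.1 (by rw [hrn y hy]; exact one_ne_zero)
  refine ⟨fun y => (r y)⁻¹ • u y, ContinuousOn.smul (ContinuousOn.inv₀ ?_ fun y hy => hr0 y hy.1)
    (huc.mono Set.inter_subset_left), fun y hy => ?_⟩
  · exact continuousOn_const.mul ((hqc.mono Set.inter_subset_left).cpow_const fun y hy => hy.2)
  · have h1 := Unitary.mem_iff.1 (hu y hy.1).1
    have hrr : star (r y)⁻¹ * (r y)⁻¹ = 1 := by
      rw [Complex.star_def, Complex.conj_mul', norm_inv, hrn y hy.1]
      simp
    have h2 : star ((r y)⁻¹ • u y) * ((r y)⁻¹ • u y) = 1 := by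
      rw [star_smul, smul_mul_smul_comm, h1.1, hrr, one_smul]
    refine ⟨Unitary.mem_iff.2 ⟨h2, mul_eq_one_comm.1 h2⟩, ?_, fun b => ?_⟩
    · rw [smul_pow, hcu y hy.1, smul_smul, inv_pow, hrk, inv_mul_cancel₀, one_smul]
      rw [← hrk]
      exact pow_ne_zero _ (hr0 y hy.1)
    · rw [(hu y hy.1).2, star_smul, smul_mul_assoc, smul_mul_smul_comm, mul_comm, hrr, one_smul]

/-- Averaging `s y ^ j * star (s x₀) ^ j` over `j` yields an intertwiner `t y` from `s x₀` to `s y`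
with `t x₀ = 1`. Where its determinant is nonzero, it carries fixed bases of the eigenspaces at `x₀`
to frames. -/
theorem exists_local_eigenframes [NeZero k] {W : Set Y} (hW : IsOpen W) {x₀ : Y} (hx₀ : x₀ ∈ W)
    {s : Y → Matrix (Fin n) (Fin n) ℂ} (hs : ContinuousOn s W)
    (hsu : s x₀ ∈ unitary (Matrix (Fin n) (Fin n) ℂ)) (hsk : ∀ y ∈ W, s y ^ k = 1) :
    ∃ W' ⊆ W, IsOpen W' ∧ x₀ ∈ W' ∧ ∀ μ : ℂ, ∃ (d : ℕ) (b : Fin d → Y → (Fin n → ℂ)),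
      (∀ i, ContinuousOn (b i) W') ∧ ∀ y ∈ W', LinearIndependent ℂ (fun i => b i y) ∧
        Submodule.span ℂ (Set.range fun i => b i y) =
          Module.End.eigenspace (Matrix.toLin' (s y)) μ := by
  have h1 := Unitary.mem_iff.1 hsu
  set t : Y → Matrix (Fin n) (Fin n) ℂ := fun y =>
    (k : ℂ)⁻¹ • ∑ j ∈ Finset.range k, s y ^ j * star (s x₀) ^ j with ht
  have htc : ContinuousOn t W := (continuous_const_smul _).comp_continuousOn <|
    continuousOn_finsetSum _ fun j _ => (hs.pow j).mul continuousOn_const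
  have htx : t x₀ = 1 := by
    have h2 : ∀ j : ℕ, s x₀ ^ j * star (s x₀) ^ j = 1 := fun j => by
      rw [← star_pow]
      exact (Unitary.mem_iff.1 (pow_mem hsu j)).2
    simp only [ht, h2]
    rw [Finset.sum_const, Finset.card_range, ← Nat.cast_smul_eq_nsmul ℂ, smul_smul,
      inv_mul_cancel₀ (by exact_mod_cast NeZero.ne k), one_smul]
  have hst : ∀ y ∈ W, s y * t y = t y * s x₀ := fun y hy => by
    have hsk' : star (s x₀) ^ k = 1 := by rw [← star_pow, hsk x₀ hx₀, star_one]
    rw [ht, mul_smul_comm, smul_mul_assoc]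
    conv_rhs => rw [← sum_range_shift (f := fun j => s y ^ j * star (s x₀) ^ j)
      (by rw [hsk y hy, hsk', pow_zero, pow_zero])]
    rw [Finset.mul_sum, Finset.sum_mul]
    congr 1
    refine Finset.sum_congr rfl fun j _ => ?_
    rw [pow_succ' (s y), pow_succ (star _), mul_assoc, mul_assoc, mul_assoc, h1.1, mul_one]
  have hdet : ContinuousOn (fun y => (t y).det) W := continuous_id.matrix_det.comp_continuousOn htc
  refine ⟨W ∩ (fun y => (t y).det) ⁻¹' {0}ᶜ, Set.inter_subset_left,
    hdet.isOpen_inter_preimage hW isOpen_compl_singleton, ⟨hx₀, by simp [htx]⟩, fun μ => ?_⟩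
  let E := Module.End.eigenspace (Matrix.toLin' (s x₀)) μ
  let b₀ := Module.finBasis ℂ E
  refine ⟨_, fun i y => (t y).mulVec (b₀ i : Fin n → ℂ), fun i => ?_, fun y hy => ?_⟩
  · exact ((continuous_id.matrix_mulVec continuous_const).comp_continuousOn htc).mono
      Set.inter_subset_left
  · have hunit : IsUnit (t y) := (Matrix.isUnit_iff_isUnit_det _).2 (isUnit_iff_ne_zero.2 hy.2)
    have hli : LinearIndependent ℂ fun i => (b₀ i : Fin n → ℂ) :=
      b₀.linearIndependent.map' E.subtype E.ker_subtype
    have hspan : Submodule.span ℂ (Set.range fun i => (b₀ i : Fin n → ℂ)) = E := by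
      have := congrArg (Submodule.map E.subtype) b₀.span_eq
      rwa [Submodule.map_span, ← Set.range_comp, Submodule.map_top, Submodule.range_subtype] at this
    constructor
    · exact hli.map' (Matrix.toLin' (t y))
        (LinearMap.ker_eq_bot.2 (Matrix.mulVec_injective_of_isUnit hunit))
    · have h2 : (Set.range fun i => (t y).mulVec (b₀ i : Fin n → ℂ)) =
          Matrix.toLin' (t y) '' Set.range fun i => (b₀ i : Fin n → ℂ) := by
        rw [← Set.range_comp]
        rfl
      rw [h2, ← Submodule.map_span, hspan]
      ext w
      rw [Submodule.mem_map, mem_eigenspace_toLin']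
      constructor
      · rintro ⟨w, hw, rfl⟩
        rw [Matrix.toLin'_apply, Matrix.mulVec_mulVec, hst y hy.1, ← Matrix.mulVec_mulVec,
          mem_eigenspace_toLin'.1 hw, Matrix.mulVec_smul]
      · intro hw
        obtain ⟨w, rfl⟩ := (Matrix.mulVec_surjective_iff_isUnit.2 hunit) w
        refine ⟨w, mem_eigenspace_toLin'.2 ?_, rfl⟩
        apply Matrix.mulVec_injective_of_isUnit hunit
        rw [Matrix.mulVec_mulVec, ← hst y hy.1, ← Matrix.mulVec_mulVec, hw, Matrix.mulVec_smul]

end LocalUnitary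

namespace MatrixBundle

variable {X : Type*} [TopologicalSpace X] {M : MatrixBundle X}

theorem continuousOn_section {n : ℕ} (e : M.Triv n) {W : Set X} (hW : IsOpen W)
    (hWe : W ⊆ e.baseSet) (s : ∀ x, M.Fiber x) :
    ContinuousOn (fun y => (⟨y, s y⟩ : M.Total)) W ↔
      ContinuousOn (fun y => (e ⟨y, s y⟩).2) W := by
  rw [hW.continuousOn_iff, hW.continuousOn_iff]
  exact forall₂_congr fun y hy => continuousAt_section e (hWe hy) s

namespace Action

variable {k : ℕ} (a : M.Action k)

theorem act_pow (x : X) (b : M.Fiber x) : (a.act x (Multiplicative.ofAdd 1))^[k] b = b := by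
  have h1 : ∀ j : ℕ, (a.act x (Multiplicative.ofAdd 1))^[j] b =
      a.act x (Multiplicative.ofAdd (j : ZMod k)) b := fun j => by
    induction j with
    | zero => simp
    | succ j ih =>
      rw [Function.iterate_succ_apply', ih, Nat.cast_succ, add_comm, ofAdd_add, map_mul]
      rfl
  rw [h1, CharP.cast_eq_zero, ofAdd_zero, map_one]
  rfl

/-- Every point has an open neighbourhood over which everything is trivial. -/
theorem exists_isTrivialOn [NeZero k] (x₀ : X) :
    ∃ W : Set X, IsOpen W ∧ x₀ ∈ W ∧ a.IsTrivialOn W := by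
  classical
  obtain ⟨n, e, hx₀, he⟩ := M.exists_trivialization x₀
  have he' := he
  choose φ hφ using he'
  let α : X → (Matrix (Fin n) (Fin n) ℂ ≃⋆ₐ[ℂ] Matrix (Fin n) (Fin n) ℂ) := fun y =>
    if h : y ∈ e.baseSet then
      ((φ y h).symm.trans (a.act y (Multiplicative.ofAdd 1))).trans (φ y h)
    else StarAlgEquiv.refl ℂ _
  have hα : ∀ y (h : y ∈ e.baseSet) b,
      α y b = φ y h (a.act y (Multiplicative.ofAdd 1) ((φ y h).symm b)) := fun y h b => by
    simp only [α, dif_pos h]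
    rfl
  have hsymm : ∀ y (h : y ∈ e.baseSet) b,
      e.toOpenPartialHomeomorph.symm (y, b) = ⟨y, (φ y h).symm b⟩ := fun y h b => by
    have h1 : e ⟨y, (φ y h).symm b⟩ = (y, b) :=
      Prod.ext (e.coe_fst (e.mem_source.2 h)) (by rw [hφ y h]; exact (φ y h).apply_symm_apply b)
    rw [← h1]
    exact e.toOpenPartialHomeomorph.left_inv (e.mem_source.2 h)
  -- In the trivialization, `α y b` is the second component of `e ∘ act ∘ e⁻¹` at `(y, b)`.
  have hαc : ∀ b, ContinuousOn (fun y => α y b) e.baseSet := fun b => by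
    have h1 : ContinuousOn (fun y => e.toOpenPartialHomeomorph.symm (y, b)) e.baseSet :=
      e.toOpenPartialHomeomorph.continuousOn_symm.comp (by fun_prop)
        fun y hy => e.mem_target.2 hy
    have h2 := (a.continuous_act (Multiplicative.ofAdd 1)).comp_continuousOn h1
    have h3 : Set.MapsTo ((fun p : M.Total =>
        (⟨p.proj, a.act p.proj (Multiplicative.ofAdd 1) p.snd⟩ : M.Total)) ∘
          fun y => e.toOpenPartialHomeomorph.symm (y, b)) e.baseSet e.source := fun y hy => by
      rw [e.mem_source, Function.comp_apply, hsymm y hy]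
      exact hy
    have h4 : ContinuousOn e e.source := e.toOpenPartialHomeomorph.continuousOn
    refine (h4.comp h2 h3).snd.congr fun y hy => ?_
    simp only [Function.comp_apply]
    rw [hsymm y hy, hα y hy, hφ y hy]
  have hαk : ∀ y ∈ e.baseSet, ∀ b, (α y)^[k] b = b := fun y hy b => by
    have h1 : ∀ j : ℕ, (α y)^[j] b =
        φ y hy ((a.act y (Multiplicative.ofAdd 1))^[j] ((φ y hy).symm b)) := fun j => by
      induction j with
      | zero => exact ((φ y hy).apply_symm_apply b).symm
      | succ j ih =>
        rw [Function.iterate_succ_apply', ih, hα y hy, Function.iterate_succ_apply']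
        congr 2
        exact (φ y hy).symm_apply_apply _
    rw [h1, a.act_pow]
    exact (φ y hy).apply_symm_apply b
  obtain ⟨W₁, hW₁, hW₁o, hxW₁, S, hSc, hS⟩ :=
    exists_local_unitary_pow_eq_one e.open_baseSet hx₀ α hαc hαk
  obtain ⟨W, hW, hWo, hxW, hframe⟩ :=
    exists_local_eigenframes hW₁o hxW₁ hSc (hS x₀ hxW₁).1 fun y hy => (hS y hy).2.1
  have hWe : W ⊆ e.baseSet := hW.trans hW₁
  let s : ∀ y, M.Fiber y := fun y => if h : y ∈ e.baseSet then (φ y h).symm (S y) else 0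
  have hs : ∀ y (h : y ∈ e.baseSet), s y = (φ y h).symm (S y) := fun y h => dif_pos h
  have hes : ∀ y ∈ e.baseSet, (e ⟨y, s y⟩).2 = S y := fun y h => by
    rw [hφ y h, hs y h]
    exact (φ y h).apply_symm_apply _
  refine ⟨W, hWo, hxW, n, e.restrOpen W hWo, s, Set.inter_eq_right.2 hWe,
    fun y hy => he y hy.1, ?_, ?_, ?_⟩
  · rw [continuousOn_section e hWo hWe]
    exact (hSc.mono hW).congr fun y hy => hes y (hWe hy)
  · intro y hy
    have hy' := hWe hy
    obtain ⟨h1, h2, h3⟩ := hS y (hW hy)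
    rw [Induces, hs y hy']
    refine ⟨?_, ?_, fun b => ?_⟩
    · rw [Unitary.mem_iff] at h1 ⊢
      rw [← map_star, ← map_mul, ← map_mul, h1.1, h1.2, map_one]
      exact ⟨rfl, rfl⟩
    · rw [← map_pow, h2, map_one]
    · apply EquivLike.injective (φ y hy')
      have h4 := h3 (φ y hy' b)
      rw [hα y hy', (φ y hy').symm_apply_apply] at h4
      rw [h4, ← map_star, map_mul, map_mul, (φ y hy').apply_symm_apply,
        (φ y hy').apply_symm_apply]
  · intro μ
    obtain ⟨d, b, hbc, hb⟩ := hframe μ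
    refine ⟨d, b, hbc, fun y hy => ⟨(hb y hy).1, ?_⟩⟩
    rw [(hb y hy).2, ← hes y (hWe hy)]
    rfl

/-- At every point, the action is induced by a unitary `v` with `v ^ k = 1`. -/
theorem exists_induces [NeZero k] (x : X) : ∃ v, a.Induces x v := by
  obtain ⟨W, -, hx, n, e, s, -, -, -, hs, -⟩ := a.exists_isTrivialOn x
  exact ⟨s x, hs x hx⟩

theorem index_lt_top [NeZero k] [CompactSpace X] : a.index < ⊤ := by
  choose W hWo hxW hW using fun x => a.exists_isTrivialOn x
  obtain ⟨t, ht⟩ := isCompact_univ.elim_finite_subcover W hWo fun x _ =>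
    Set.mem_iUnion.2 ⟨x, hxW x⟩
  -- An index bound `m` calls for `m + 1` sets; padding with `∅` provides them, even when `t` is
  -- empty.
  refine lt_of_le_of_lt (sInf_le ⟨t.card, rfl,
    Fin.cons ∅ fun i => W (t.equivFin.symm i), ?_, ?_⟩) (ENat.natCast_lt_top t.card)
  · intro i
    refine Fin.cases ?_ (fun i => ?_) i
    · exact ⟨isOpen_empty, ∅, by simp, by simp, by simp⟩
    · exact ⟨hWo _, {W (t.equivFin.symm i)}, by simpa using ⟨hWo _, hW _⟩, by simp, by simp⟩
  · refine Set.eq_univ_of_forall fun x => ?_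
    obtain ⟨y, hy, hxy⟩ := Set.mem_iUnion₂.1 (ht (Set.mem_univ x))
    refine Set.mem_iUnion.2 ⟨(t.equivFin ⟨y, hy⟩).succ, ?_⟩
    simpa using hxy

end Action

end MatrixBundle

/-! ### The shift unitary of an equidimensional eigenframe -/

section GramSchmidt

open InnerProductSpace

variable {Y E : Type*} [TopologicalSpace Y] [NormedAddCommGroup E] [InnerProductSpace ℂ E] {d : ℕ}
  {W : Set Y} {b : Fin d → Y → E}

/-- Strong induction along the Gram–Schmidt recursion; linear independence keeps the denominators
away from zero. -/
theorem ContinuousOn.gramSchmidt (hb : ∀ i, ContinuousOn (b i) W)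
    (hli : ∀ y ∈ W, LinearIndependent ℂ fun i => b i y) (i : Fin d) :
    ContinuousOn (fun y => InnerProductSpace.gramSchmidt ℂ (fun j => b j y) i) W := by
  induction i using WellFoundedLT.induction with
  | ind i ih =>
    have h : ∀ y, InnerProductSpace.gramSchmidt ℂ (fun j => b j y) i = b i y -
        ∑ j ∈ Finset.Iio i, (Inner.inner ℂ (InnerProductSpace.gramSchmidt ℂ (fun j => b j y) j)
          (b i y) / ((‖InnerProductSpace.gramSchmidt ℂ (fun j => b j y) j‖ : ℝ) : ℂ) ^ 2) •
            InnerProductSpace.gramSchmidt ℂ (fun j => b j y) j := fun y =>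
      eq_sub_of_add_eq (gramSchmidt_def'' ℂ (fun j => b j y) i).symm
    refine ContinuousOn.congr ?_ fun y _ => h y
    refine (hb i).sub (continuousOn_finsetSum _ fun j hj => ?_)
    have hj' := ih j (Finset.mem_Iio.1 hj)
    refine ContinuousOn.smul (ContinuousOn.div (hj'.inner (hb i)) ?_ fun y hy => ?_) hj'
    · exact (Complex.continuous_ofReal.comp_continuousOn hj'.norm).pow 2
    · exact pow_ne_zero 2 (Complex.ofReal_ne_zero.2 (norm_ne_zero_iff.2
        (gramSchmidt_ne_zero j (hli y hy))))

theorem ContinuousOn.gramSchmidtNormed (hb : ∀ i, ContinuousOn (b i) W)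
    (hli : ∀ y ∈ W, LinearIndependent ℂ fun i => b i y) (i : Fin d) :
    ContinuousOn (fun y => InnerProductSpace.gramSchmidtNormed ℂ (fun j => b j y) i) W := by
  have h := ContinuousOn.gramSchmidt hb hli i
  refine ContinuousOn.smul (ContinuousOn.inv₀
    (Complex.continuous_ofReal.comp_continuousOn h.norm) fun y hy => ?_) h
  exact Complex.ofReal_ne_zero.2 (norm_ne_zero_iff.2 (gramSchmidt_ne_zero i (hli y hy)))

end GramSchmidt

section Shift

variable {k : ℕ} [NeZero k] {ζ : ℂ} {n d : ℕ}

/-- The cyclic shift of the eigenspaces in the model `ℂ^(ℤ/k) ⊗ ℂ^d`. -/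
def shiftMatrix (k d : ℕ) [NeZero k] : Matrix (ZMod k × Fin d) (ZMod k × Fin d) ℂ :=
  Matrix.permMatrixHom ((Equiv.addRight (1 : ZMod k)).prodCongr (Equiv.refl (Fin d)))

theorem shiftMatrix_apply (q r : ZMod k × Fin d) :
    shiftMatrix k d q r = if q = (r.1 + 1, r.2) then 1 else 0 := by
  simp only [shiftMatrix, Matrix.permMatrixHom_apply, PEquiv.toMatrix_apply,
    Equiv.toPEquiv_apply, Option.mem_some_iff, Equiv.Perm.inv_eq_iff_eq]
  rfl

theorem star_shiftMatrix_mul_self : star (shiftMatrix k d) * shiftMatrix k d = 1 := by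
  simp only [shiftMatrix, Matrix.permMatrixHom_apply, Matrix.star_eq_conjTranspose,
    Matrix.conjTranspose_permMatrix]
  rw [← Matrix.permMatrix_mul, inv_inv, inv_mul_cancel, Matrix.permMatrix_one]

theorem shiftMatrix_pow : shiftMatrix k d ^ k = 1 := by
  rw [shiftMatrix, ← map_pow]
  have h : ∀ (j : ℕ) (q : ZMod k × Fin d),
      (((Equiv.addRight (1 : ZMod k)).prodCongr (Equiv.refl (Fin d)) : Equiv.Perm _) ^ j) q =
        (q.1 + j, q.2) := fun j q => by
    induction j with
    | zero => simp
    | succ j ih =>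
      rw [pow_succ', Equiv.Perm.mul_apply, ih]
      simp [add_assoc]
  convert map_one (Matrix.permMatrixHom (n := ZMod k × Fin d) (R := ℂ))
  ext1 q
  rw [h]
  simp

/-- The clock-and-shift relation: the model of `S w = ζ w S`. -/
theorem diagonal_mul_shiftMatrix (hζ : IsPrimitiveRoot ζ k) :
    Matrix.diagonal (fun q : ZMod k × Fin d => rootChar ζ q.1) * shiftMatrix k d =
      ζ • (shiftMatrix k d * Matrix.diagonal fun q : ZMod k × Fin d => rootChar ζ q.1) := by
  ext q r
  rw [Matrix.diagonal_mul, Matrix.smul_apply, Matrix.mul_diagonal, shiftMatrix_apply]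
  split_ifs with h
  · rw [h, rootChar_add_one hζ]
    simp
  · simp

/-- Transport of the shift matrix along an orthonormal basis of eigenvectors. -/
theorem shiftMatrix_conj (hζ : IsPrimitiveRoot ζ k) {S : Matrix (Fin n) (Fin n) ℂ}
    {T : Matrix (Fin n) (ZMod k × Fin d) ℂ} (hT : T.conjTranspose * T = 1)
    (hT' : T * T.conjTranspose = 1)
    (hST : S * T = T * Matrix.diagonal fun q : ZMod k × Fin d => rootChar ζ q.1)
    {w : Matrix (Fin n) (Fin n) ℂ} (hw : w = T * shiftMatrix k d * T.conjTranspose) :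
    w ∈ unitary (Matrix (Fin n) (Fin n) ℂ) ∧ w ^ k = 1 ∧ S * w * star S = ζ • w := by
  set P := shiftMatrix k d
  set D := Matrix.diagonal fun q : ZMod k × Fin d => rootChar ζ q.1 with hD
  have hmul : ∀ A B : Matrix (ZMod k × Fin d) (ZMod k × Fin d) ℂ,
      (T * A * T.conjTranspose) * (T * B * T.conjTranspose) = T * (A * B) * T.conjTranspose :=
    fun A B => by
      calc (T * A * T.conjTranspose) * (T * B * T.conjTranspose)
          = T * A * (T.conjTranspose * T) * B * T.conjTranspose := by simp only [Matrix.mul_assoc]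
        _ = T * (A * B) * T.conjTranspose := by
          rw [hT, Matrix.mul_one]
          simp only [Matrix.mul_assoc]
  have hstar : ∀ A : Matrix (ZMod k × Fin d) (ZMod k × Fin d) ℂ,
      star (T * A * T.conjTranspose) = T * star A * T.conjTranspose := fun A => by
    simp only [Matrix.star_eq_conjTranspose, Matrix.conjTranspose_mul,
      Matrix.conjTranspose_conjTranspose, Matrix.mul_assoc]
  have hDD : D * star D = 1 := by
    rw [Matrix.star_eq_conjTranspose, hD, Matrix.diagonal_conjTranspose,
      Matrix.diagonal_mul_diagonal, ← Matrix.diagonal_one]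
    congr 1
    ext q
    rw [mul_comm]
    exact star_rootChar_mul_self hζ q.1
  have hS : S = T * D * T.conjTranspose := by
    rw [← hST, Matrix.mul_assoc, hT', Matrix.mul_one]
  have h1 : star w * w = 1 := by
    rw [hw, hstar, hmul, star_shiftMatrix_mul_self, Matrix.mul_one, hT']
  refine ⟨Unitary.mem_iff.2 ⟨h1, mul_eq_one_comm.1 h1⟩, ?_, ?_⟩
  · have hpow : ∀ j : ℕ, w ^ j = T * P ^ j * T.conjTranspose := fun j => by
      induction j with
      | zero => rw [pow_zero, pow_zero, Matrix.mul_one, hT']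
      | succ j ih => rw [pow_succ, ih, hw, hmul, ← pow_succ]
    rw [hpow, shiftMatrix_pow, Matrix.mul_one, hT']
  · rw [hS, hw, hstar, hmul, hmul, diagonal_mul_shiftMatrix hζ, Matrix.smul_mul, Matrix.mul_assoc P,
      hDD, Matrix.mul_one, Matrix.mul_smul, Matrix.smul_mul]

/-- The common rank `d` lets the orthonormalized frames be collected into one matrix `T y` indexed
by `ZMod k × Fin d`, along which the constant cyclic shift is transported. -/
theorem exists_shift_of_eigenframes {Y : Type*} [TopologicalSpace Y] (hζ : IsPrimitiveRoot ζ k)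
    {W : Set Y} {S : Y → Matrix (Fin n) (Fin n) ℂ}
    (hS : ∀ y ∈ W, S y ∈ unitary (Matrix (Fin n) (Fin n) ℂ)) (hSk : ∀ y ∈ W, S y ^ k = 1)
    {b : ZMod k → Fin d → Y → (Fin n → ℂ)} (hb : ∀ g i, ContinuousOn (b g i) W)
    (hli : ∀ g, ∀ y ∈ W, LinearIndependent ℂ fun i => b g i y)
    (hspan : ∀ g, ∀ y ∈ W, Submodule.span ℂ (Set.range fun i => b g i y) =
      Module.End.eigenspace (Matrix.toLin' (S y)) (rootChar ζ g)) :
    ∃ w : Y → Matrix (Fin n) (Fin n) ℂ, ContinuousOn w W ∧ ∀ y ∈ W,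
      w y ∈ unitary (Matrix (Fin n) (Fin n) ℂ) ∧ w y ^ k = 1 ∧
        S y * w y * star (S y) = ζ • w y := by
  let L := (WithLp.linearEquiv 2 ℂ (Fin n → ℂ)).symm
  let B : ZMod k → Fin d → Y → EuclideanSpace ℂ (Fin n) := fun g i y => L (b g i y)
  have hBc : ∀ g i, ContinuousOn (B g i) W := fun g i =>
    (PiLp.continuous_toLp 2 _).comp_continuousOn (hb g i)
  have hBli : ∀ g, ∀ y ∈ W, LinearIndependent ℂ fun i => B g i y := fun g y hy =>
    (hli g y hy).map' L.toLinearMap (LinearMap.ker_eq_bot.2 L.injective)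
  let c : ZMod k → Fin d → Y → EuclideanSpace ℂ (Fin n) := fun g i y =>
    InnerProductSpace.gramSchmidtNormed ℂ (fun j => B g j y) i
  have hcc : ∀ g i, ContinuousOn (c g i) W := fun g i =>
    ContinuousOn.gramSchmidtNormed (hBc g) (hBli g) i
  have hco : ∀ g, ∀ y ∈ W, Orthonormal ℂ fun i => c g i y := fun g y hy =>
    InnerProductSpace.gramSchmidtNormed_orthonormal (hBli g y hy)
  have hce : ∀ g i, ∀ y ∈ W, (S y).mulVec (c g i y).ofLp = rootChar ζ g • (c g i y).ofLp :=
    fun g i y hy => by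
      have h1 : c g i y ∈ Submodule.span ℂ (Set.range fun i => B g i y) := by
        rw [← InnerProductSpace.span_gramSchmidt, ← InnerProductSpace.span_gramSchmidtNormed_range]
        exact Submodule.subset_span ⟨i, rfl⟩
      have h2 : (Set.range fun i => B g i y) = L.toLinearMap '' Set.range fun i => b g i y := by
        rw [← Set.range_comp]
        rfl
      rw [h2, ← Submodule.map_span, hspan g y hy] at h1
      obtain ⟨v, hv, hvc⟩ := h1
      rw [← hvc]
      exact mem_eigenspace_toLin'.1 hv
  let T : Y → Matrix (Fin n) (ZMod k × Fin d) ℂ := fun y =>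
    Matrix.of fun p q => (c q.1 q.2 y).ofLp p
  have hTc : ContinuousOn T W := continuousOn_pi.2 fun p => continuousOn_pi.2 fun q =>
    (EuclideanSpace.proj (𝕜 := ℂ) p).continuous.comp_continuousOn (hcc q.1 q.2)
  refine ⟨fun y => T y * shiftMatrix k d * (T y).conjTranspose, ?_, fun y hy => ?_⟩
  · have h1 : Continuous fun A : Matrix (Fin n) (ZMod k × Fin d) ℂ =>
        A * shiftMatrix k d * A.conjTranspose := by fun_prop
    exact h1.comp_continuousOn hTc
  have hST : S y * T y = T y * Matrix.diagonal fun q : ZMod k × Fin d => rootChar ζ q.1 := by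
    ext p q
    rw [Matrix.mul_diagonal, mul_comm]
    exact congrFun (hce q.1 q.2 y hy) p
  have hTT : (T y).conjTranspose * T y = 1 := by
    ext q r
    have hin : ((T y).conjTranspose * T y) q r = inner ℂ (c q.1 q.2 y) (c r.1 r.2 y) := by
      rw [Matrix.mul_apply, PiLp.inner_apply]
      refine Finset.sum_congr rfl fun p _ => ?_
      rw [RCLike.inner_apply, mul_comm]
      rfl
    by_cases hqr : q.1 = r.1
    · rw [hin, ← hqr, orthonormal_iff_ite.1 (hco q.1 y hy) q.2 r.2, Matrix.one_apply]
      simp only [Prod.ext_iff, hqr, true_and]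
    -- Columns from different eigenspaces are orthogonal because `S y` is unitary.
    · have h1 : (T y).conjTranspose * T y =
          (S y * T y).conjTranspose * (S y * T y) := by
        rw [Matrix.conjTranspose_mul, Matrix.mul_assoc, ← Matrix.mul_assoc _ (S y),
          ← Matrix.star_eq_conjTranspose (S y), (Unitary.mem_iff.1 (hS y hy)).1, Matrix.one_mul]
      rw [hST, Matrix.conjTranspose_mul, Matrix.diagonal_conjTranspose, Matrix.mul_assoc,
        ← Matrix.mul_assoc _ (T y)] at h1
      have h2 := congrFun (congrFun h1 q) r
      rw [Matrix.diagonal_mul, Matrix.mul_diagonal] at h2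
      have h3 := star_rootChar_mul_self hζ q.1
      set z := ((T y).conjTranspose * T y) q r
      have h4 : (rootChar ζ q.1 - rootChar ζ r.1) * z = 0 := by
        have h5 : rootChar ζ q.1 * z =
            (star (rootChar ζ q.1) * rootChar ζ q.1) * z * rootChar ζ r.1 := by
          conv_lhs => rw [h2]
          simp only [Pi.star_apply]
          ring
        rw [h3] at h5
        linear_combination h5
      rw [Matrix.one_apply_ne fun h => hqr (congrArg Prod.fst h)]
      exact (mul_eq_zero.1 h4).resolve_left
        (sub_ne_zero.2 fun h => hqr (rootChar_injective hζ h))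
  -- The eigenspaces exhaust `ℂⁿ`, so `k * d = n`; the isometry `T y` is thus square and therefore
  -- unitary.
  have hcard : Fintype.card (ZMod k × Fin d) = Fintype.card (Fin n) := by
    have h1 := sum_finrank_eigenspace hζ (hSk y hy)
    have h2 : ∀ g : ZMod k, Module.finrank ℂ
        (Module.End.eigenspace (Matrix.toLin' (S y)) (rootChar ζ g)) = d := fun g => by
      rw [← hspan g y hy, finrank_span_eq_card (hli g y hy), Fintype.card_fin]
    rw [Finset.sum_congr rfl fun g _ => h2 g] at h1
    rw [Fintype.card_prod, Fintype.card_fin, Fintype.card_fin, ← h1]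
    simp
  exact shiftMatrix_conj hζ hTT ((Matrix.mul_eq_one_comm_of_card_eq _ _ _ hcard).1 hTT) hST rfl

end Shift

/-! ### Extension by zero from `(0, 1]` -/

section coneExtend

variable {G : Type*} [TopologicalSpace G]

/-- The extension by zero of `f(·, g)` from `(0, 1]` to `ℝ`. -/
def coneExtend (f : C₀(Set.Ioc (0 : ℝ) 1 × G, ℂ)) (g : G) (t : ℝ) : ℂ :=
  open Classical in if h : t ∈ Set.Ioc (0 : ℝ) 1 then f (⟨t, h⟩, g) else 0

variable {f f' : C₀(Set.Ioc (0 : ℝ) 1 × G, ℂ)} {g : G} {t : ℝ}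

theorem coneExtend_of_mem (h : t ∈ Set.Ioc (0 : ℝ) 1) : coneExtend f g t = f (⟨t, h⟩, g) :=
  dif_pos h

theorem coneExtend_of_notMem (h : t ∉ Set.Ioc (0 : ℝ) 1) : coneExtend f g t = 0 :=
  dif_neg h

theorem coneExtend_zero_right : coneExtend f g 0 = 0 :=
  coneExtend_of_notMem (by simp)

theorem coneExtend_zero : coneExtend (0 : C₀(Set.Ioc (0 : ℝ) 1 × G, ℂ)) g t = 0 := by
  by_cases h : t ∈ Set.Ioc (0 : ℝ) 1
  · rw [coneExtend_of_mem h]; rfl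
  · exact coneExtend_of_notMem h

theorem coneExtend_add : coneExtend (f + f') g t = coneExtend f g t + coneExtend f' g t := by
  by_cases h : t ∈ Set.Ioc (0 : ℝ) 1
  · simp only [coneExtend_of_mem h]; rfl
  · simp [coneExtend_of_notMem h]

theorem coneExtend_mul : coneExtend (f * f') g t = coneExtend f g t * coneExtend f' g t := by
  by_cases h : t ∈ Set.Ioc (0 : ℝ) 1
  · simp only [coneExtend_of_mem h]; rfl
  · simp [coneExtend_of_notMem h]

theorem coneExtend_smul (c : ℂ) : coneExtend (c • f) g t = c * coneExtend f g t := by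
  by_cases h : t ∈ Set.Ioc (0 : ℝ) 1
  · simp only [coneExtend_of_mem h]; rfl
  · simp [coneExtend_of_notMem h]

theorem coneExtend_star : coneExtend (star f) g t = star (coneExtend f g t) := by
  by_cases h : t ∈ Set.Ioc (0 : ℝ) 1
  · simp only [coneExtend_of_mem h]; rfl
  · simp [coneExtend_of_notMem h]

theorem coneExtend_coneTranslate [Group G] [IsTopologicalGroup G] (h : G) :
    coneExtend (coneTranslate h f) g t = coneExtend f (g * h) t := by
  by_cases ht : t ∈ Set.Ioc (0 : ℝ) 1
  · simp only [coneExtend_of_mem ht]; rfl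
  · simp [coneExtend_of_notMem ht]

theorem coneExtend_coneCoordinate [CompactSpace G] (ht : t ∈ Set.Icc (0 : ℝ) 1) :
    coneExtend (coneCoordinate G) g t = t := by
  obtain h | h := ht.1.eq_or_lt
  · rw [← h, coneExtend_zero_right, Complex.ofReal_zero]
  · rw [coneExtend_of_mem ⟨h, ht.2⟩]
    rfl

/-- At 0 this is vanishing at infinity: a compact set off which `f` is small projects to a compact
set missing 0. The restriction to `[0, 1]` is needed, since the extension may jump at 1. -/
theorem continuousOn_coneExtend (f : C₀(Set.Ioc (0 : ℝ) 1 × G, ℂ)) (g : G) :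
    ContinuousOn (coneExtend f g) (Set.Icc 0 1) := by
  intro t ht
  obtain h | h := ht.1.eq_or_lt
  · subst h
    rw [ContinuousWithinAt, coneExtend_zero_right, Metric.tendsto_nhds]
    intro ε hε
    have h1 := Metric.tendsto_nhds.1 (zero_at_infty f) ε hε
    rw [Filter.eventually_iff, Filter.mem_cocompact] at h1
    obtain ⟨K, hK, hKf⟩ := h1
    have hK' : IsCompact ((fun p : Set.Ioc (0 : ℝ) 1 × G => (p.1 : ℝ)) '' K) :=
      hK.image (by fun_prop)
    have h0 : (0 : ℝ) ∈ ((fun p : Set.Ioc (0 : ℝ) 1 × G => (p.1 : ℝ)) '' K)ᶜ := by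
      rintro ⟨p, -, hp⟩
      exact p.1.2.1.ne' hp
    refine mem_nhdsWithin_of_mem_nhds ?_
    filter_upwards [hK'.isClosed.isOpen_compl.mem_nhds h0] with t ht
    by_cases h : t ∈ Set.Ioc (0 : ℝ) 1
    · rw [coneExtend_of_mem h]
      exact hKf fun hp => ht ⟨_, hp, rfl⟩
    · rw [coneExtend_of_notMem h, dist_self]
      exact hε
  · have h1 : ContinuousOn (coneExtend f g) (Set.Ioc 0 1) := by
      rw [continuousOn_iff_continuous_domRestrict]
      have h2 : Continuous fun t : Set.Ioc (0 : ℝ) 1 => f (t, g) := by fun_prop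
      refine h2.congr fun t => ?_
      rw [Set.domRestrict_apply, coneExtend_of_mem t.2]
    refine (h1 t ⟨h, ht.2⟩).mono_of_mem_nhdsWithin ?_
    filter_upwards [self_mem_nhdsWithin, mem_nhdsWithin_of_mem_nhds (lt_mem_nhds h)] with r h2 h3
    exact ⟨h3, h2.2⟩

end coneExtend

/-! ### Continuous shifts, their equivariant homomorphisms, and the bound by the index -/

namespace MatrixBundle

variable {X : Type*} [TopologicalSpace X] {M : MatrixBundle X}

namespace Action

variable {k : ℕ} (a : M.Action k)

/-- A unitary `w` in a fibre with `w ^ k = 1` on which the generator acts as multiplication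
by `ζ`. -/
def IsShift (ζ : ℂ) {x : X} (w : M.Fiber x) : Prop :=
  w ∈ unitary (M.Fiber x) ∧ w ^ k = 1 ∧ a.act x (Multiplicative.ofAdd 1) w = ζ • w

variable {a} [NeZero k] {ζ : ℂ}

theorem IsShift.act_eq {x : X} {w : M.Fiber x} (hw : a.IsShift ζ w)
    (g : Multiplicative (ZMod k)) : a.act x g w = rootChar ζ g.toAdd • w := by
  have h : ∀ j : ℕ, a.act x (Multiplicative.ofAdd (j : ZMod k)) w = ζ ^ j • w := fun j => by
    induction j with
    | zero => simp
    | succ j ih =>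
      rw [Nat.cast_succ, ofAdd_add, map_mul]
      change a.act x _ (a.act x _ w) = _
      rw [hw.2.2, map_smul, ih, smul_smul, pow_succ']
  have h2 := h g.toAdd.val
  rwa [ZMod.natCast_zmod_val, ofAdd_toAdd] at h2

/-- A trivial piece with equidimensional eigenspaces admits a continuous shift. -/
theorem IsTrivialOn.exists_isShift (hζ : IsPrimitiveRoot ζ k) {W : Set X} (hW : IsOpen W)
    (h : a.IsTrivialOn W)
    (heq : ∀ (x : X) (n : ℕ) (φ : M.Fiber x ≃⋆ₐ[ℂ] Matrix (Fin n) (Fin n) ℂ) (v : M.Fiber x),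
      a.Induces x v → EquidimEigenspaces φ ζ v) :
    ∃ w : ∀ x, M.Fiber x, ContinuousOn (fun x => (⟨x, w x⟩ : M.Total)) W ∧
      ∀ x ∈ W, a.IsShift ζ (w x) := by
  classical
  obtain rfl | ⟨x₀, hx₀⟩ := W.eq_empty_or_nonempty
  · exact ⟨fun _ => 0, continuousOn_empty _, by simp⟩
  obtain ⟨n, e, s, rfl, he, hsc, hs, hframe⟩ := h
  choose φ hφ using he
  choose D b hbc hb using fun g : ZMod k => hframe (rootChar ζ g)
  -- The frame lengths are constant over the piece, so comparing them at the single point `x₀`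
  -- suffices.
  have hD : ∀ g, D g = D 0 := fun g => by
    have h1 : ∀ g : ZMod k, Module.finrank ℂ (Module.End.eigenspace
        (Matrix.toLin' (e ⟨x₀, s x₀⟩).2) (rootChar ζ g)) = D g := fun g => by
      rw [← (hb g x₀ hx₀).2, finrank_span_eq_card (hb g x₀ hx₀).1, Fintype.card_fin]
    rw [← h1 g, ← h1 0, hφ x₀ hx₀]
    exact heq x₀ n (φ x₀ hx₀) (s x₀) (hs x₀ hx₀) _ _
  have hb' : ∀ g : ZMod k, ∃ b : Fin (D 0) → X → (Fin n → ℂ),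
      (∀ i, ContinuousOn (b i) e.baseSet) ∧ ∀ x ∈ e.baseSet,
        LinearIndependent ℂ (fun i => b i x) ∧ Submodule.span ℂ (Set.range fun i => b i x) =
          Module.End.eigenspace (Matrix.toLin' (e ⟨x, s x⟩).2) (rootChar ζ g) := fun g => by
    rw [← hD g]
    exact ⟨b g, hbc g, hb g⟩
  choose b' hbc' hb' using hb'
  have hS : ∀ y ∈ e.baseSet,
      (e ⟨y, s y⟩).2 ∈ unitary (Matrix (Fin n) (Fin n) ℂ) := fun y hy => by
    have h1 := Unitary.mem_iff.1 (hs y hy).1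
    rw [hφ y hy, Unitary.mem_iff, ← map_star, ← map_mul, ← map_mul, h1.1, h1.2, map_one]
    exact ⟨rfl, rfl⟩
  have hSk : ∀ y ∈ e.baseSet, (e ⟨y, s y⟩).2 ^ k = 1 := fun y hy => by
    rw [hφ y hy, ← map_pow, (hs y hy).2.1, map_one]
  obtain ⟨w, hwc, hw⟩ := exists_shift_of_eigenframes hζ hS hSk hbc' (fun g y hy => (hb' g y hy).1)
    fun g y hy => (hb' g y hy).2
  let w' : ∀ y, M.Fiber y := fun y => if h : y ∈ e.baseSet then (φ y h).symm (w y) else 0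
  have hw' : ∀ y (h : y ∈ e.baseSet), φ y h (w' y) = w y := fun y h => by
    have h1 : w' y = (φ y h).symm (w y) := dif_pos h
    rw [h1]
    exact (φ y h).apply_symm_apply _
  refine ⟨w', ?_, fun y hy => ?_⟩
  · rw [continuousOn_section e hW subset_rfl]
    exact hwc.congr fun y hy => by rw [hφ y hy, hw' y hy]
  · obtain ⟨h1, h2, h3⟩ := hw y hy
    rw [Unitary.mem_iff] at h1
    have hinj := EquivLike.injective (φ y hy)
    refine ⟨Unitary.mem_iff.2 ⟨hinj ?_, hinj ?_⟩, hinj ?_, hinj ?_⟩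
    · rw [map_mul, map_star, hw' y hy, h1.1, map_one]
    · rw [map_mul, map_star, hw' y hy, h1.2, map_one]
    · rw [map_pow, hw' y hy, h2, map_one]
    · rw [(hs y hy).act_one, map_mul, map_mul, map_star, map_smul, hw' y hy, ← h3, hφ y hy]

/-- Shifts on the disjoint open pieces glue with no compatibility condition, even if the ranks
differ. -/
theorem IsClopenTrivialOn.exists_isShift (hζ : IsPrimitiveRoot ζ k) {U : Set X}
    (h : a.IsClopenTrivialOn U)
    (heq : ∀ (x : X) (n : ℕ) (φ : M.Fiber x ≃⋆ₐ[ℂ] Matrix (Fin n) (Fin n) ℂ) (v : M.Fiber x),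
      a.Induces x v → EquidimEigenspaces φ ζ v) :
    ∃ w : ∀ x, M.Fiber x, ContinuousOn (fun x => (⟨x, w x⟩ : M.Total)) U ∧
      ∀ x ∈ U, a.IsShift ζ (w x) := by
  classical
  obtain ⟨𝒲, h𝒲, hdisj, rfl⟩ := h
  choose! w hwc hw using fun W (hW : W ∈ 𝒲) => (h𝒲 W hW).2.exists_isShift hζ (h𝒲 W hW).1 heq
  let w' : ∀ x, M.Fiber x := fun x => if h : ∃ W ∈ 𝒲, x ∈ W then w h.choose x else 0
  have hw' : ∀ W ∈ 𝒲, ∀ x ∈ W, w' x = w W x := fun W hW x hx => by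
    have h : ∃ W ∈ 𝒲, x ∈ W := ⟨W, hW, hx⟩
    have h1 : w' x = w h.choose x := dif_pos h
    have h2 : h.choose = W := by
      by_contra h3
      exact Set.disjoint_left.1 (hdisj h.choose_spec.1 hW h3) h.choose_spec.2 hx
    rw [h1, h2]
  refine ⟨w', ?_, ?_⟩
  · rintro x ⟨W, hW, hx⟩
    have h1 := ((h𝒲 W hW).1.continuousOn_iff.1 (hwc W hW)) hx
    refine (h1.congr ?_).continuousWithinAt
    filter_upwards [(h𝒲 W hW).1.mem_nhds hx] with y hy
    rw [hw' W hW y hy]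
  · rintro x ⟨W, hW, hx⟩
    rw [hw' W hW x hx]
    exact hw W hW x hx

/-- The fibrewise value of the equivariant `*`-homomorphism determined by a shift `w`. -/
def shiftMap (ζ : ℂ) (f : C₀(Set.Ioc (0 : ℝ) 1 × Multiplicative (ZMod k), ℂ)) (t : ℝ) {x : X}
    (w : M.Fiber x) : M.Fiber x :=
  ∑ g : ZMod k, coneExtend f (Multiplicative.ofAdd g) t • rootProj k w (rootChar ζ g)

section shiftMap

variable {f f' : C₀(Set.Ioc (0 : ℝ) 1 × Multiplicative (ZMod k), ℂ)} {t : ℝ} {x : X}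
  {w : M.Fiber x}

theorem shiftMap_zero_right : shiftMap ζ f 0 w = 0 := by
  simp [shiftMap, coneExtend_zero_right]

theorem shiftMap_zero : shiftMap ζ (0 : C₀(Set.Ioc (0 : ℝ) 1 × Multiplicative (ZMod k), ℂ)) t w =
    0 := by
  simp [shiftMap, coneExtend_zero]

theorem shiftMap_add : shiftMap ζ (f + f') t w = shiftMap ζ f t w + shiftMap ζ f' t w := by
  simp only [shiftMap, coneExtend_add, add_smul, Finset.sum_add_distrib]

theorem shiftMap_smul (c : ℂ) : shiftMap ζ (c • f) t w = c • shiftMap ζ f t w := by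
  simp only [shiftMap, coneExtend_smul, mul_smul, Finset.smul_sum]

theorem IsShift.shiftMap_mul (hw : a.IsShift ζ w) (hζ : IsPrimitiveRoot ζ k) :
    shiftMap ζ (f * f') t w = shiftMap ζ f t w * shiftMap ζ f' t w := by
  simp only [shiftMap, Finset.sum_mul_sum, smul_mul_smul_comm, rootProj_mul_rootProj hζ hw.2.1,
    coneExtend_mul]
  simp

theorem IsShift.shiftMap_star (hw : a.IsShift ζ w) (hζ : IsPrimitiveRoot ζ k) :
    shiftMap ζ (star f) t w = star (shiftMap ζ f t w) := by
  simp only [shiftMap, star_sum, star_smul, star_rootProj hζ hw.2.1 hw.1, coneExtend_star]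

/-- Acting by `h` scales `w` by `ζ ^ h`, hence turns the projection of index `g` into that of index
`g - h`; reindexing the sum moves the translation onto `f`. -/
theorem IsShift.act_shiftMap (hw : a.IsShift ζ w) (hζ : IsPrimitiveRoot ζ k)
    (h : Multiplicative (ZMod k)) :
    a.act x h (shiftMap ζ f t w) = shiftMap ζ (coneTranslate h f) t w := by
  simp only [shiftMap, map_sum, map_smul, map_rootProj, hw.act_eq, rootProj_smul,
    coneExtend_coneTranslate]
  rw [← Equiv.sum_comp (Equiv.addRight h.toAdd)]
  refine Finset.sum_congr rfl fun g _ => ?_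
  rw [Equiv.coe_addRight, rootChar_add hζ, mul_comm (rootChar ζ g),
    inv_mul_cancel_left₀ (rootChar_ne_zero hζ _), ofAdd_add, ofAdd_toAdd]

theorem shiftMap_coneCoordinate (hζ : IsPrimitiveRoot ζ k) (ht : t ∈ Set.Icc (0 : ℝ) 1) :
    shiftMap ζ (coneCoordinate (Multiplicative (ZMod k))) t w = (t : ℂ) • 1 := by
  simp only [shiftMap, coneExtend_coneCoordinate ht]
  rw [← Finset.smul_sum, sum_rootProj hζ]

end shiftMap

/-- Outside `U` the values of `w` are arbitrary, but there `τ` vanishes locally and every `f`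
extends by 0 at `t = 0`. -/
theorem shiftMap_mem_sections {U : Set X} (hU : IsOpen U) {w : ∀ x, M.Fiber x}
    (hwc : ContinuousOn (fun x => (⟨x, w x⟩ : M.Total)) U) (τ : C(X, ℝ))
    (hτ : ∀ x, τ x ∈ Set.Icc (0 : ℝ) 1) (hτU : tsupport τ ⊆ U)
    (f : C₀(Set.Ioc (0 : ℝ) 1 × Multiplicative (ZMod k), ℂ)) :
    (fun x => shiftMap ζ f (τ x) (w x)) ∈ M.sections := by
  refine continuous_iff_continuousAt.2 fun x => ?_
  by_cases hx : x ∈ U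
  · obtain ⟨n, e, hxe, he⟩ := M.exists_trivialization x
    rw [continuousAt_section e hxe]
    have h1 := (continuousAt_section e hxe w).1 (hU.continuousOn_iff.1 hwc hx)
    have h2 : ∀ g, Continuous fun y => coneExtend f g (τ y) := fun g =>
      (continuousOn_coneExtend f g).comp_continuous τ.continuous hτ
    have hP : ∀ μ, Continuous fun v : Matrix (Fin n) (Fin n) ℂ => rootProj k v μ := fun μ => by
      unfold rootProj
      fun_prop
    have h3 : ContinuousAt (fun y => ∑ g : ZMod k, coneExtend f (Multiplicative.ofAdd g) (τ y) •
        rootProj k (e ⟨y, w y⟩).2 (rootChar ζ g)) x := by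
      refine tendsto_finsetSum _ fun g _ => (h2 _).continuousAt.smul ?_
      exact (hP _).continuousAt.comp h1
    refine h3.congr ?_
    filter_upwards [e.open_baseSet.mem_nhds hxe] with y hy
    obtain ⟨φ, hφ⟩ := he y hy
    simp only [hφ, shiftMap, map_sum, map_smul, map_rootProj]
  · have h0 : Continuous fun x => (⟨x, 0⟩ : M.Total) := zero_mem M.sections
    refine h0.continuousAt.congr ?_
    have hx' : x ∈ (tsupport τ)ᶜ := fun h => hx (hτU h)
    filter_upwards [(isClosed_tsupport τ).isOpen_compl.mem_nhds hx'] with y hy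
    rw [image_eq_zero_of_notMem_tsupport hy, shiftMap_zero_right]

/-- The equivariant `*`-homomorphism `C₀((0,1]) ⊗ C(ℤ/k) → Γ(M)` determined by a continuous shift
over an open set and a bump function supported there. -/
def shiftHom (hζ : IsPrimitiveRoot ζ k) {U : Set X} (hU : IsOpen U) {w : ∀ x, M.Fiber x}
    (hwc : ContinuousOn (fun x => (⟨x, w x⟩ : M.Total)) U) (hw : ∀ x ∈ U, a.IsShift ζ (w x))
    (τ : C(X, ℝ)) (hτ : ∀ x, τ x ∈ Set.Icc (0 : ℝ) 1) (hτU : tsupport τ ⊆ U) :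
    C₀(Set.Ioc (0 : ℝ) 1 × Multiplicative (ZMod k), ℂ) →⋆ₙₐ[ℂ] M.sections where
  toFun f := ⟨fun x => shiftMap ζ f (τ x) (w x), shiftMap_mem_sections hU hwc τ hτ hτU f⟩
  map_smul' _ _ := Subtype.ext <| funext fun _ => shiftMap_smul _
  map_zero' := Subtype.ext <| funext fun _ => shiftMap_zero
  map_add' _ _ := Subtype.ext <| funext fun _ => shiftMap_add
  map_mul' f f' := Subtype.ext <| funext fun x => by
    change shiftMap ζ (f * f') (τ x) (w x) = shiftMap ζ f (τ x) (w x) * shiftMap ζ f' (τ x) (w x)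
    by_cases hx : x ∈ tsupport τ
    · exact (hw x (hτU hx)).shiftMap_mul hζ
    · simp [image_eq_zero_of_notMem_tsupport hx, shiftMap_zero_right]
  map_star' f := Subtype.ext <| funext fun x => by
    change shiftMap ζ (star f) (τ x) (w x) = star (shiftMap ζ f (τ x) (w x))
    by_cases hx : x ∈ tsupport τ
    · exact (hw x (hτU hx)).shiftMap_star hζ
    · simp [image_eq_zero_of_notMem_tsupport hx, shiftMap_zero_right]

/-- Each member of a cover admissible for the index carries a shift. With a subordinate partition of
unity, `t ⊗ 1` goes to `τ i • 1` under the `i`-th homomorphism, and these sum to 1. -/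
theorem ltDim_le_index [CompactSpace X] [T2Space X] (hζ : IsPrimitiveRoot ζ k)
    (heq : ∀ (x : X) (n : ℕ) (φ : M.Fiber x ≃⋆ₐ[ℂ] Matrix (Fin n) (Fin n) ℂ) (v : M.Fiber x),
      a.Induces x v → EquidimEigenspaces φ ζ v) : ltDim a.onSections ≤ a.index := by
  refine le_sInf ?_
  rintro _ ⟨m, rfl, U, hU, hcover⟩
  choose w hwc hw using fun i => (hU i).2.exists_isShift hζ heq
  obtain ⟨τ, hτ⟩ := PartitionOfUnity.exists_isSubordinate isClosed_univ U (fun i => (hU i).1)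
    hcover.ge
  refine sInf_le ⟨m, rfl, fun i => shiftHom hζ (hU i).1 (hwc i) (hw i) (τ i)
    (fun x => ⟨τ.nonneg i x, τ.le_one i x⟩) (hτ i), fun i g f => ?_, ?_⟩
  · refine Subtype.ext <| funext fun x => ?_
    change a.act x g (shiftMap ζ f (τ i x) (w i x)) =
      shiftMap ζ (coneTranslate g f) (τ i x) (w i x)
    by_cases hx : x ∈ tsupport (τ i)
    · exact (hw i x (hτ i hx)).act_shiftMap hζ g
    · simp [image_eq_zero_of_notMem_tsupport hx, shiftMap_zero_right]
  · refine Subtype.ext <| funext fun x => ?_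
    simp only [AddSubmonoidClass.coe_finsetSum, Finset.sum_apply]
    change ∑ i, shiftMap ζ (coneCoordinate (Multiplicative (ZMod k))) (τ i x) (w i x) = 1
    simp only [shiftMap_coneCoordinate hζ ⟨τ.nonneg _ x, τ.le_one _ x⟩]
    have h1 := τ.sum_eq_one (Set.mem_univ x)
    rw [finsum_eq_sum_of_fintype] at h1
    rw [← Finset.sum_smul, ← Complex.ofReal_sum, h1, Complex.ofReal_one, one_smul]

end Action

end MatrixBundle

theorem mainTheorem6 {X : Type*} [TopologicalSpace X] [CompactSpace X] [T2Space X]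
    (k : ℕ) [NeZero k] (ζ : ℂ) (hζ : IsPrimitiveRoot ζ k)
    (M : MatrixBundle X) (a : M.Action k) :
    List.TFAE
      [ltDim a.onSections ≤ a.index,
       ltDim a.onSections < ⊤,
       ∀ x : X, ∃ (n : ℕ) (φ : M.Fiber x ≃⋆ₐ[ℂ] Matrix (Fin n) (Fin n) ℂ) (v : M.Fiber x),
         a.Induces x v ∧ MatrixBundle.EquidimEigenspaces φ ζ v,
       ∀ (x : X) (n : ℕ) (φ : M.Fiber x ≃⋆ₐ[ℂ] Matrix (Fin n) (Fin n) ℂ) (v : M.Fiber x),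
         a.Induces x v → MatrixBundle.EquidimEigenspaces φ ζ v] := by
  tfae_have 1 → 2 := fun h => h.trans_lt a.index_lt_top
  tfae_have 2 → 4 := fun h _ _ φ _ hv =>
    MatrixBundle.equidimEigenspaces_of_ltDim_lt_top hζ h φ hv
  tfae_have 4 → 3 := fun h x => by
    obtain ⟨n, ⟨φ⟩⟩ := M.exists_fiber_equiv x
    obtain ⟨v, hv⟩ := a.exists_induces x
    exact ⟨n, φ, v, hv, h x n φ v hv⟩
  tfae_have 3 → 4 := fun h x m ψ v' hv' => by
    obtain ⟨n, φ, v, hv, hφ⟩ := h x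
    exact hv.equidimEigenspaces hζ ψ hv' hφ
  tfae_have 4 → 1 := MatrixBundle.Action.ltDim_le_index hζ
  tfae_finish

end
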